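/- Let $K$ be a perfect field, let $m\ge 2$ be an integer not divisible by the characteristic of $K$, and let $F\in K[x]$ be a separable polynomial of degree $r\ge 2$ that splits over $K$, with (distinct) roots $\alpha_1,\dots,\alpha_r\in K$. Let $C$ be the smooth projective model of the affine curve $y^m=F(x)$, let $J(C)$ be its Jacobian, whose group of points over $\overline K$ is the group of divisor classes of degree zero on $C_{\overline K}$, and put $d=\gcd(m,r)$. Let $R_i$ be the point $(\alpha_i,0)$ of $C$ and let $\infty$ be the formal sum of the points at infinity of $C_{\overline K}$, i.e. of the points that do not lie on the affine curve. For all integers $a_1,\dots,a_r$ whose sum is divisible by $d$, the divisor $$\sum_{i=1}^r a_iR_i-\frac1d\Big(\sum_{i=1}^r a_i\Big)\infty$$ has degree zero. Let $\Delta$ be the set of the classes of all these divisors in $J(C)$. Then $\Delta$ is a subgroup of $J(C)$, and $$\Delta\cong(\mathbb Z/m\mathbb Z)^{r-2}\times\Big(\mathbb Z/\tfrac md\mathbb Z\Big).$$ -/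

import Mathlib

universe u

/-- The data of a superelliptic curve `y ^ m = F(x)` over a field `k`: an integer `m ≥ 2` that is
not divisible by the characteristic of `k`, and a nonconstant separable polynomial `F`. -/
structure SuperellipticCurve (k : Type u) [Field k] where
  /-- the exponent of `y` -/
  m : ℕ
  /-- the right-hand side -/
  F : Polynomial k
  two_le_m : 2 ≤ m
  m_ne_zero : (m : k) ≠ 0
  separable : F.Separable
  natDegree_pos : 0 < F.natDegree

namespace SuperellipticCurve

noncomputable section

section Field

variable {k : Type u} [Field k] (C : SuperellipticCurve k)

/-- `r = deg F`. -/
def r : ℕ := C.F.natDegree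

/-- `d = gcd(m, r)`. -/
def d : ℕ := Nat.gcd C.m C.r

/-- The base change of the curve to an extension `L` of `k`. -/
def baseChange (L : Type u) [Field L] [Algebra k L] : SuperellipticCurve L where
  m := C.m
  F := C.F.map (algebraMap k L)
  two_le_m := C.two_le_m
  m_ne_zero := by
    have h := (algebraMap k L).injective.ne C.m_ne_zero
    simpa using h
  separable := C.separable.map
  natDegree_pos := by
    rw [Polynomial.natDegree_map]
    exact C.natDegree_pos

/-- The polynomial `Y ^ m - F(X)` in `k[X][Y]`. -/
def equation : Polynomial (Polynomial k) := Polynomial.X ^ C.m - Polynomial.C C.F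

theorem equation_monic : C.equation.Monic :=
  Polynomial.monic_X_pow_sub_C _ (by have := C.two_le_m; omega)

theorem natDegree_equation : C.equation.natDegree = C.m :=
  Polynomial.natDegree_X_pow_sub_C

theorem irreducible_equation : Irreducible C.equation := by
  have hm := C.two_le_m
  have hF0 : C.F ≠ 0 := C.separable.ne_zero
  have hFu : ¬ IsUnit C.F := fun h =>
    absurd (Polynomial.natDegree_eq_zero_of_isUnit h) C.natDegree_pos.ne'
  obtain ⟨p, hp, hpF⟩ := WfDvdMonoid.exists_irreducible_factor hFu hF0
  have hmon := C.equation_monic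
  refine Polynomial.irreducible_of_eisenstein_criterion (P := Ideal.span {p})
    ((Ideal.span_singleton_prime hp.ne_zero).2 hp.prime) ?_ ?_ ?_ ?_ hmon.isPrimitive
  · rw [hmon.leadingCoeff, Ideal.mem_span_singleton]
    exact fun h => hp.not_isUnit (isUnit_of_dvd_one h)
  · intro n hn
    have hn' : n < C.m := by
      have := Polynomial.coe_lt_degree.1 hn
      rwa [C.natDegree_equation] at this
    rw [equation, Polynomial.coeff_sub, Polynomial.coeff_X_pow, if_neg hn'.ne, zero_sub,
      Polynomial.coeff_C, Ideal.mem_span_singleton]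
    split_ifs
    · exact (dvd_neg).2 hpF
    · simp
  · rw [← Polynomial.natDegree_pos_iff_degree_pos, C.natDegree_equation]
    omega
  · rw [equation, Polynomial.coeff_sub, Polynomial.coeff_X_pow, if_neg (by omega), zero_sub,
      Polynomial.coeff_C_zero, Ideal.span_singleton_pow, Ideal.mem_span_singleton, dvd_neg, sq]
    exact fun h => hp.not_isUnit (C.separable.squarefree p h)

/-- The coordinate ring `k[x, y] / (y ^ m - F(x))` of the affine curve. -/
abbrev CoordinateRing : Type u := AdjoinRoot C.equation

instance : IsDomain C.CoordinateRing :=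
  AdjoinRoot.isDomain_of_prime C.irreducible_equation.prime

instance : IsNoetherianRing C.CoordinateRing :=
  inferInstanceAs (IsNoetherianRing (Polynomial (Polynomial k) ⧸ Ideal.span {C.equation}))

/-- The function field of the curve. -/
abbrev FunctionField : Type u := FractionRing C.CoordinateRing

/-- The function `x` in the coordinate ring. -/
def xCoord : C.CoordinateRing := AdjoinRoot.of C.equation Polynomial.X

/-- The function `y` in the coordinate ring. -/
def yCoord : C.CoordinateRing := AdjoinRoot.root C.equation

/-- The closed points of the smooth projective model, that is of the abstract nonsingular curve
of the function field: the discrete valuation rings of the function field that contain the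
constants. -/
@[ext]
structure Point where
  /-- the local ring of the point -/
  localRing : ValuationSubring C.FunctionField
  algebraMap_mem : ∀ a : k, algebraMap k C.FunctionField a ∈ localRing
  isDVR : IsDiscreteValuationRing localRing

variable {C}

instance (P : C.Point) : IsDiscreteValuationRing P.localRing := P.isDVR

/-- The order of vanishing of a nonzero function at a point. -/
def Point.ord (P : C.Point) (f : C.FunctionField) : ℤ :=
  -WithZero.log ((IsDiscreteValuationRing.maximalIdeal P.localRing).valuation C.FunctionField f)

theorem Point.ord_one (P : C.Point) : P.ord 1 = 0 := by
  simp [Point.ord]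

theorem Point.ord_mul (P : C.Point) {f g : C.FunctionField} (hf : f ≠ 0) (hg : g ≠ 0) :
    P.ord (f * g) = P.ord f + P.ord g := by
  simp only [Point.ord]
  rw [map_mul, WithZero.log_mul ((Valuation.ne_zero_iff _).2 hf) ((Valuation.ne_zero_iff _).2 hg)]
  ring

theorem Point.ord_inv (P : C.Point) (f : C.FunctionField) : P.ord f⁻¹ = -P.ord f := by
  simp only [Point.ord]
  rw [map_inv₀, WithZero.log_inv]

variable (C)

/-- The points at infinity: the points that do not lie on the affine curve, that is, at which
not both coordinate functions are regular. -/
def pointsAtInfinity : Set C.Point :=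
  {P | ¬ (algebraMap C.CoordinateRing C.FunctionField C.xCoord ∈ P.localRing ∧
    algebraMap C.CoordinateRing C.FunctionField C.yCoord ∈ P.localRing)}

/-- The group of divisors. -/
abbrev Divisor : Type u := C.Point →₀ ℤ

/-- The formal sum of the points at infinity. -/
def infinity : C.Divisor := ∑ᶠ P ∈ C.pointsAtInfinity, Finsupp.single P 1

/-- The group of principal divisors `div f`, where `f` is a nonzero function. -/
def principal : AddSubgroup C.Divisor where
  carrier := {D | ∃ f : C.FunctionField, f ≠ 0 ∧ ∀ P : C.Point, D P = P.ord f}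
  zero_mem' := ⟨1, one_ne_zero, fun P => by simp [P.ord_one]⟩
  add_mem' := by
    rintro D E ⟨f, hf, hD⟩ ⟨g, hg, hE⟩
    exact ⟨f * g, mul_ne_zero hf hg, fun P => by
      rw [P.ord_mul hf hg, Finsupp.add_apply, hD, hE]⟩
  neg_mem' := by
    rintro D ⟨f, hf, hD⟩
    exact ⟨f⁻¹, inv_ne_zero hf, fun P => by rw [P.ord_inv, Finsupp.neg_apply, hD]⟩

variable {C}

/-- Evaluation of regular functions of the affine curve at the point `(a, 0)`, where `a` is a
root of `F`. -/
def evalRoot {a : k} (ha : C.F.IsRoot a) : C.CoordinateRing →+* k :=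
  AdjoinRoot.lift (Polynomial.evalRingHom a) 0 (by
    have hm := C.two_le_m
    have hF : Polynomial.eval a C.F = 0 := ha
    simp [equation, hF, show C.m ≠ 0 by omega])

instance {a : k} (ha : C.F.IsRoot a) : (RingHom.ker (evalRoot ha)).IsPrime :=
  RingHom.ker_isPrime _

/-- The local ring of the point `(a, 0)`, as a subring of the function field: the fractions
`f / g` of regular functions on the affine curve with `g(a, 0) ≠ 0`. -/
def rootLocalRing {a : k} (ha : C.F.IsRoot a) : Subalgebra C.CoordinateRing C.FunctionField :=
  Localization.subalgebra.ofField C.FunctionField (RingHom.ker (evalRoot ha)).primeCompl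
    (Ideal.primeCompl_le_nonZeroDivisors _)

theorem mem_rootLocalRing {a : k} (ha : C.F.IsRoot a) (f : C.FunctionField) :
    f ∈ rootLocalRing ha ↔ ∃ p q : C.CoordinateRing, evalRoot ha q ≠ 0 ∧
      f = algebraMap C.CoordinateRing C.FunctionField p /
        algebraMap C.CoordinateRing C.FunctionField q := by
  constructor
  · rintro ⟨p, q, hq, h⟩
    exact ⟨p, q, hq, by rw [div_eq_mul_inv]; exact h⟩
  · rintro ⟨p, q, hq, h⟩
    exact ⟨p, q, hq, by rw [div_eq_mul_inv] at h; exact h⟩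

theorem mem_ker_evalRoot {a : k} (ha : C.F.IsRoot a) {f : C.CoordinateRing}
    (hf : evalRoot ha f = 0) : ∃ g h : C.CoordinateRing,
      f = g * AdjoinRoot.of C.equation (Polynomial.X - Polynomial.C a) + h * C.yCoord := by
  obtain ⟨p, rfl⟩ := AdjoinRoot.mk_surjective f
  have hp : (p.coeff 0).IsRoot a := by
    rw [evalRoot, AdjoinRoot.lift_mk, Polynomial.eval₂_at_zero] at hf
    exact hf
  obtain ⟨g, hg⟩ := Polynomial.dvd_iff_isRoot.2 hp
  refine ⟨AdjoinRoot.of C.equation g, AdjoinRoot.mk C.equation p.divX, ?_⟩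
  conv_lhs => rw [← Polynomial.divX_mul_X_add p]
  rw [map_add, map_mul, AdjoinRoot.mk_X, AdjoinRoot.mk_C, hg, map_mul, yCoord]
  ring

theorem yCoord_pow : C.yCoord ^ C.m = AdjoinRoot.of C.equation C.F := by
  have h : AdjoinRoot.mk C.equation (Polynomial.X ^ C.m - Polynomial.C C.F) = 0 :=
    AdjoinRoot.mk_self
  rw [map_sub, map_pow, AdjoinRoot.mk_X, AdjoinRoot.mk_C, sub_eq_zero] at h
  exact h

theorem yCoord_ne_zero : C.yCoord ≠ 0 := by
  intro h
  have h' := C.yCoord_pow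
  have hm := C.two_le_m
  rw [h, zero_pow (by omega)] at h'
  have hinj := AdjoinRoot.of.injective_of_degree_ne_zero (f := C.equation) (by
    intro h0
    have h1 := C.natDegree_equation
    have h2 : C.equation.natDegree = 0 := Polynomial.natDegree_eq_of_degree_eq_some h0
    omega)
  exact C.separable.ne_zero (hinj (by rw [← h', map_zero]))

theorem isDVR_rootLocalRing {a : k} (ha : C.F.IsRoot a) :
    IsDiscreteValuationRing (rootLocalRing ha) := by
  set P := RingHom.ker (evalRoot ha) with hP
  have hloc : IsLocalization.AtPrime (rootLocalRing ha) P :=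
    Localization.subalgebra.isLocalization_ofField _ _ _
  have := IsLocalization.AtPrime.isLocalRing (rootLocalRing ha) P
  have : IsNoetherianRing (rootLocalRing ha) :=
    IsLocalization.isNoetherianRing P.primeCompl _ inferInstance
  have hmap := IsLocalization.AtPrime.map_eq_maximalIdeal P (rootLocalRing ha)
  have hm := C.two_le_m
  have hyP : C.yCoord ∈ P := by
    rw [hP, RingHom.mem_ker, evalRoot, yCoord, AdjoinRoot.lift_root]
  have hinj : Function.Injective (algebraMap C.CoordinateRing (rootLocalRing ha)) :=
    IsLocalization.injective _ (Ideal.primeCompl_le_nonZeroDivisors P)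
  set y := algebraMap C.CoordinateRing (rootLocalRing ha) C.yCoord with hy
  have hymax : y ∈ IsLocalRing.maximalIdeal (rootLocalRing ha) := by
    rw [← hmap]
    exact Ideal.mem_map_of_mem _ hyP
  have hy0 : y ≠ 0 := fun h => C.yCoord_ne_zero (hinj (by rw [← hy, h, map_zero]))
  have hnf : ¬ IsField (rootLocalRing ha) := by
    intro hf
    rw [IsLocalRing.isField_iff_maximalIdeal_eq] at hf
    rw [hf] at hymax
    exact hy0 hymax
  obtain ⟨G, hG⟩ := Polynomial.dvd_iff_isRoot.2 ha
  have hGa : evalRoot ha (AdjoinRoot.of C.equation G) ≠ 0 := by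
    intro h
    have h1 : Polynomial.eval a G = 0 := by
      simpa [evalRoot, AdjoinRoot.lift_of] using h
    obtain ⟨H, hH⟩ := Polynomial.dvd_iff_isRoot.2 h1
    exact (Polynomial.not_isUnit_X_sub_C a) (C.separable.squarefree _ ⟨H, by rw [hG, hH]; ring⟩)
  have hGu : IsUnit (algebraMap C.CoordinateRing (rootLocalRing ha)
      (AdjoinRoot.of C.equation G)) :=
    IsLocalization.map_units (rootLocalRing ha)
      (⟨AdjoinRoot.of C.equation G, hGa⟩ : P.primeCompl)
  have hx : y ∣ algebraMap C.CoordinateRing (rootLocalRing ha)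
      (AdjoinRoot.of C.equation (Polynomial.X - Polynomial.C a)) := by
    rw [← hGu.dvd_mul_right, ← map_mul, ← map_mul, ← hG, ← C.yCoord_pow, map_pow]
    exact dvd_pow_self _ (by omega)
  have hspan : IsLocalRing.maximalIdeal (rootLocalRing ha) = Ideal.span {y} := by
    apply le_antisymm
    · rw [← hmap, Ideal.map_le_iff_le_comap]
      intro f hf
      obtain ⟨g, h, rfl⟩ := mem_ker_evalRoot ha hf
      rw [Ideal.mem_comap, Ideal.mem_span_singleton, map_add, map_mul, map_mul]
      exact dvd_add (hx.mul_left _) (Dvd.intro_left _ rfl)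
    · rw [Ideal.span_singleton_le_iff_mem]
      exact hymax
  have hprin : (IsLocalRing.maximalIdeal (rootLocalRing ha)).IsPrincipal := ⟨⟨y, hspan⟩⟩
  have htfae := (IsDiscreteValuationRing.TFAE (rootLocalRing ha) hnf).out 0 4
  exact htfae.2 hprin

/-- The point `(a, 0)` of the curve, where `a` is a root of `F`. -/
def rootPoint {a : k} (ha : C.F.IsRoot a) : C.Point where
  localRing := ValuationSubring.ofSubring (rootLocalRing ha).toSubring (by
    intro f
    have := isDVR_rootLocalRing ha
    have : IsFractionRing (rootLocalRing ha) C.FunctionField :=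
      Localization.subalgebra.isFractionRing_ofField _ _ _
    obtain ⟨g, hg⟩ | ⟨g, hg⟩ := ValuationRing.isInteger_or_isInteger (rootLocalRing ha) f
    · exact Or.inl (hg ▸ g.2)
    · exact Or.inr (hg ▸ g.2))
  algebraMap_mem := fun b => (rootLocalRing ha).algebraMap_mem
    (algebraMap k C.CoordinateRing b)
  isDVR := isDVR_rootLocalRing ha

end Field

section AlgClosed

variable {k : Type u} [Field k] [IsAlgClosed k] (C : SuperellipticCurve k)

/-- The degree of a divisor. The ground field is algebraically closed, so every point has
degree one. -/
def degree : C.Divisor →+ ℤ := Finsupp.degree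

/-- The group of divisors of degree zero. -/
def divisorZero : AddSubgroup C.Divisor := C.degree.ker

/-- The group of divisor classes of degree zero: the points of the Jacobian over the
algebraically closed ground field. -/
abbrev PicZero : Type u := C.divisorZero ⧸ C.principal.addSubgroupOf C.divisorZero

end AlgClosed

section Jacobian

variable {K : Type u} [Field K] (C : SuperellipticCurve K)

/-- The curve over the algebraic closure of the base field. -/
def geometric : SuperellipticCurve (AlgebraicClosure K) := C.baseChange (AlgebraicClosure K)

/-- The group `J(C)` of geometric points of the Jacobian. -/
abbrev Jacobian : Type u := C.geometric.PicZero

variable {C}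

theorem isRoot_geometric {α : Fin C.r → K}
    (hF : C.F = Polynomial.C C.F.leadingCoeff * ∏ i, (Polynomial.X - Polynomial.C (α i)))
    (i : Fin C.r) : C.geometric.F.IsRoot (algebraMap K (AlgebraicClosure K) (α i)) := by
  have h : C.F.IsRoot (α i) := by
    rw [hF, Polynomial.IsRoot.def, Polynomial.eval_mul, Polynomial.eval_prod,
      Finset.prod_eq_zero (Finset.mem_univ i) (by simp), mul_zero]
  exact h.map

/-- The divisor `∑ i, a i • R i - b • ∞`, where `R i` is the point `(α i, 0)`. -/
def rootDivisor {α : Fin C.r → K}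
    (hF : C.F = Polynomial.C C.F.leadingCoeff * ∏ i, (Polynomial.X - Polynomial.C (α i)))
    (a : Fin C.r → ℤ) (b : ℤ) : C.geometric.Divisor :=
  ∑ i, Finsupp.single (rootPoint (isRoot_geometric hF i)) (a i) - b • C.geometric.infinity

/-- The set `Δ` of the classes in `J(C)` of the divisors `∑ i, a i • R i - (1/d) (∑ i, a i) • ∞`,
where the `a i` are integers whose sum is divisible by `d`. -/
def Delta {α : Fin C.r → K}
    (hF : C.F = Polynomial.C C.F.leadingCoeff * ∏ i, (Polynomial.X - Polynomial.C (α i))) :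
    Set C.Jacobian :=
  {c | ∃ (a : Fin C.r → ℤ) (b : ℤ) (D : C.geometric.divisorZero), ∑ i, a i = C.d * b ∧
    (D : C.geometric.Divisor) = rootDivisor hF a b ∧ c = QuotientAddGroup.mk D}

end Jacobian

end

end SuperellipticCurve

/-! Write D_a = ∑ a_i R_i - b ∞ with d b = ∑ a_i. The map x is totally ramified over each α_i, so
div y = ∑ R_i - (r/d) ∞ and div (x - α_i) = m R_i - (m/d) ∞ (`ord_y`, `ord_prod_x_sub`).

The heart is `mem_principal_iff`: D_a is principal exactly when all a_i are congruent modulo m. If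
they are, D_a is an integral combination of the divisors above. Conversely, if D_a = div f, then f^m
and ∏ (x - α_i)^(a_i) have the same divisor, hence differ by a constant. So the map y ↦ ω y, with ω
a primitive m-th root of unity, multiplies f by some ω^j. Comparing coefficients in the basis 1, y,
..., y^(m-1) over k(x) gives f = y^j h(x). At each R_i the order of y is 1 and that of h(x) is
divisible by m, so a_i ≡ j for every i.

Hence Δ is the group of tuples with d ∣ ∑ a_i modulo the tuples that are constant modulo m.
`exists_surjective_sumDvdSubgroup` computes it: r - 2 differences a_i - a_r are free in ℤ/m, and (∑
a_i)/d - (r/d) a_r is free in ℤ/(m/d).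

The geometry is done with places. Over an algebraically closed field every nontrivial valuation ring
containing the constants is the local ring of a smooth point of a plane model
(`exists_eq_div_of_smooth`): y^m = F(x) where x is regular, and near infinity a model in s and z =
y^(m/d)/x^(r/d), where s is a local parameter and z^d takes the value of the leading coefficient.
This yields the local parameters, the d points at infinity (so ∞ has degree d), and, since a
nonconstant function has a pole at some such ring, the constancy of functions with zero divisor. -/

namespace PlaneCurve

/-! ### Valuation rings as local rings of smooth points of plane curves -/

variable {L E : Type*} [Field L] [Field E] [Algebra L E]

/-- Over constants that lie in a valuation ring, nonzero constants are units. -/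
theorem valuation_algebraMap_eq_one {V : ValuationSubring E} (hV : ∀ a : L, algebraMap L E a ∈ V)
    {a : L} (ha : a ≠ 0) : V.valuation (algebraMap L E a) = 1 := by
  refine le_antisymm ((V.valuation_le_one_iff _).2 (hV a)) ?_
  have h := (V.valuation_le_one_iff _).2 (hV a⁻¹)
  have h0 : V.valuation (algebraMap L E a) ≠ 0 := by simpa using ha
  rw [map_inv₀, map_inv₀] at h
  exact (inv_le_one₀ (zero_lt_iff.2 h0)).1 h

theorem adjoin_subset {V : ValuationSubring E} (hV : ∀ a : L, algebraMap L E a ∈ V)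
    {S : Set E} (hS : ∀ f ∈ S, f ∈ V) {f : E} (hf : f ∈ Algebra.adjoin L S) : f ∈ V := by
  induction hf using Algebra.adjoin_induction with
  | mem x hx => exact hS x hx
  | algebraMap a => exact hV a
  | add x y _ _ hx hy => exact V.add_mem _ _ hx hy
  | mul x y _ _ hx hy => exact V.mul_mem _ _ hx hy

theorem aeval_mem {V : ValuationSubring E} (hV : ∀ a : L, algebraMap L E a ∈ V)
    {f : E} (hf : f ∈ V) (p : Polynomial L) : Polynomial.aeval f p ∈ V :=
  adjoin_subset hV (S := {f}) (by simpa using hf) (Polynomial.aeval_mem_adjoin_singleton L f)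

/-- If a polynomial in `f` with constant coefficients is not a unit of a valuation ring, then `f`
is congruent to one of its roots. -/
theorem exists_isRoot_valuation_sub_lt_one [IsAlgClosed L] {V : ValuationSubring E}
    (hV : ∀ a : L, algebraMap L E a ∈ V) {f : E} {p : Polynomial L} (hp : p ≠ 0)
    (h : V.valuation (Polynomial.aeval f p) < 1) :
    ∃ b : L, p.IsRoot b ∧ V.valuation (f - algebraMap L E b) < 1 := by
  by_contra! hcon
  have hs := (IsAlgClosed.splits p).eq_prod_roots
  -- If `f` had no root of `p` as residue, every linear factor would have value at least 1, and so
  -- would their product.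
  have key : ∀ s : Multiset L, (∀ b ∈ s, p.IsRoot b) →
      1 ≤ V.valuation (Polynomial.aeval f (s.map fun b => Polynomial.X - Polynomial.C b).prod) := by
    intro s
    induction s using Multiset.induction_on with
    | empty => simp
    | cons b s ih =>
      intro hb
      rw [Multiset.map_cons, Multiset.prod_cons, map_mul, map_mul]
      refine one_le_mul (by simpa using hcon b (hb b (by simp))) (ih fun c hc => hb c (by simp [hc]))
  have h1 := key p.roots fun b hb => (Polynomial.mem_roots'.1 hb).2
  rw [hs, map_mul, map_mul, Polynomial.aeval_C,
    valuation_algebraMap_eq_one hV (Polynomial.leadingCoeff_ne_zero.2 hp), one_mul] at h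
  exact absurd h (not_lt.2 h1)

theorem mem_of_pow_mem {V : ValuationSubring E} {f : E} {n : ℕ} (hn : n ≠ 0) (h : f ^ n ∈ V) :
    f ∈ V := by
  rw [← V.valuation_le_one_iff, map_pow] at h
  rw [← V.valuation_le_one_iff]
  exact (pow_le_one_iff hn).1 h

/-- A valuation ring dominating a local ring of a noetherian domain whose maximal ideal is
generated by one element `s` is equal to that local ring, and is a discrete valuation ring. -/
theorem exists_eq_div_and_isDiscreteValuationRing {V : ValuationSubring E} {A : Subalgebra L E}
    [IsNoetherianRing A] [IsFractionRing A E] (hAV : ∀ f ∈ A, f ∈ V) {s : E} (hsA : s ∈ A)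
    (hs0 : s ≠ 0) (hs : V.valuation s < 1)
    (hgen : ∀ f ∈ A, V.valuation f < 1 → ∃ q ∈ A, V.valuation q = 1 ∧ ∃ g ∈ A, q * f = g * s) :
    (∀ f ∈ V, ∃ p ∈ A, ∃ q ∈ A, V.valuation q = 1 ∧ f = p / q) ∧
      (∀ f, V.valuation f < 1 → ∃ g ∈ V, f = g * s) ∧ IsDiscreteValuationRing V := by
  let ι : A →+* V := A.val.toRingHom.codRestrict V.toSubring fun f => hAV f f.2
  -- `P` is the center of `V` on `A`, and the elements of `A` outside `P` are those of value 1. The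
  -- goal is that the localization `B` of `A` at `P` is a discrete valuation ring and equals `V`.
  let P : Ideal A := (IsLocalRing.maximalIdeal V).comap ι
  have hPprime : P.IsPrime := Ideal.IsPrime.comap ι
  have hP : ∀ f : A, f ∈ P ↔ V.valuation (f : E) < 1 := fun f => by
    rw [Ideal.mem_comap, V.valuation_lt_one_iff]; rfl
  have hP' : ∀ f : A, f ∈ P.primeCompl ↔ V.valuation (f : E) = 1 := fun f => by
    change ¬ f ∈ P ↔ _
    rw [hP, not_lt]
    exact ⟨fun h => le_antisymm ((V.valuation_le_one_iff _).2 (hAV f f.2)) h, fun h => h.ge⟩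
  let B := Localization.subalgebra.ofField E P.primeCompl (Ideal.primeCompl_le_nonZeroDivisors P)
  have hB : ∀ f : E, f ∈ B ↔ ∃ p ∈ A, ∃ q ∈ A, V.valuation q = 1 ∧ f = p / q := by
    intro f
    constructor
    · rintro ⟨p, q, hq, h⟩
      exact ⟨p, p.2, q, q.2, (hP' q).1 hq, by rw [div_eq_mul_inv]; exact h⟩
    · rintro ⟨p, hp, q, hq, hq1, h⟩
      exact ⟨⟨p, hp⟩, ⟨q, hq⟩, (hP' _).2 hq1, by rw [div_eq_mul_inv] at h; exact h⟩
  have hloc : IsLocalization.AtPrime B P := Localization.subalgebra.isLocalization_ofField _ _ _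
  have hfrac : IsFractionRing B E := Localization.subalgebra.isFractionRing_ofField _ _ _
  have := IsLocalization.AtPrime.isLocalRing B P
  have : IsNoetherianRing B := IsLocalization.isNoetherianRing P.primeCompl _ inferInstance
  have hmap := IsLocalization.AtPrime.map_eq_maximalIdeal P B
  have hinj : Function.Injective (algebraMap A B) :=
    IsLocalization.injective _ (Ideal.primeCompl_le_nonZeroDivisors P)
  set t := algebraMap A B ⟨s, hsA⟩ with ht
  have htmax : t ∈ IsLocalRing.maximalIdeal B := by
    rw [← hmap]
    exact Ideal.mem_map_of_mem _ ((hP _).2 hs)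
  have ht0 : t ≠ 0 := fun h => hs0 (congrArg Subtype.val
    (hinj (h.trans (map_zero (algebraMap A B)).symm)))
  have hnf : ¬ IsField B := by
    intro hf
    rw [IsLocalRing.isField_iff_maximalIdeal_eq] at hf
    rw [hf] at htmax
    exact ht0 htmax
  have hspan : IsLocalRing.maximalIdeal B = Ideal.span {t} := by
    apply le_antisymm
    · rw [← hmap, Ideal.map_le_iff_le_comap]
      intro f hf
      obtain ⟨q, hq, hq1, g, hg, h⟩ := hgen f f.2 ((hP f).1 hf)
      have hqu : IsUnit (algebraMap A B ⟨q, hq⟩) :=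
        IsLocalization.map_units B (⟨(⟨q, hq⟩ : A), (hP' _).2 hq1⟩ : P.primeCompl)
      rw [Ideal.mem_comap, Ideal.mem_span_singleton, ← hqu.dvd_mul_left, ← map_mul,
        show (⟨q, hq⟩ : A) * f = (⟨g, hg⟩ : A) * (⟨s, hsA⟩ : A) from Subtype.ext h, map_mul]
      exact Dvd.intro_left _ rfl
    · rw [Ideal.span_singleton_le_iff_mem]
      exact htmax
  have hprin : (IsLocalRing.maximalIdeal B).IsPrincipal := ⟨⟨t, hspan⟩⟩
  have htfae := (IsDiscreteValuationRing.TFAE B hnf).out 0 4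
  have hDVR : IsDiscreteValuationRing B := htfae.2 hprin
  have hmem : ∀ f : E, f ∈ B ∨ f⁻¹ ∈ B := by
    intro f
    obtain ⟨g, hg⟩ | ⟨g, hg⟩ := ValuationRing.isInteger_or_isInteger B f
    · exact Or.inl (hg ▸ g.2)
    · exact Or.inr (hg ▸ g.2)
  have hVB : ∀ f : E, f ∈ V ↔ f ∈ B := by
    intro f
    constructor
    · intro hf
      by_contra hfB
      -- Here `f⁻¹ = p / q` lies in `B`. If `p` has value less than 1, then so does `f⁻¹`, against
      -- `f ∈ V`; otherwise `p` is an allowed denominator and `f = q / p` lies in `B`.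
      obtain ⟨p, hp, q, hq, hq1, h⟩ := (hB _).1 ((hmem f).resolve_left hfB)
      obtain hp1 | hp1 := lt_or_eq_of_le ((V.valuation_le_one_iff p).2 (hAV p hp))
      · have h1 : V.valuation f⁻¹ < 1 := by rwa [h, map_div₀, hq1, div_one]
        have hf0 : f ≠ 0 := fun h0 => hfB (h0 ▸ zero_mem B)
        have h2 : V.valuation f * V.valuation f⁻¹ = 1 := by
          rw [← map_mul, mul_inv_cancel₀ hf0, map_one]
        have h3 := mul_le_mul_left ((V.valuation_le_one_iff f).2 hf) (V.valuation f⁻¹)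
        rw [h2, one_mul] at h3
        exact absurd h1 (not_lt.2 h3)
      · exact hfB ((hB f).2 ⟨q, hq, p, hp, hp1, by rw [← inv_inv f, h, inv_div]⟩)
    · intro hf
      obtain ⟨p, hp, q, hq, hq1, rfl⟩ := (hB f).1 hf
      rw [← V.valuation_le_one_iff, map_div₀, hq1, div_one]
      exact (V.valuation_le_one_iff _).2 (hAV p hp)
  refine ⟨fun f hf => (hB f).1 ((hVB f).1 hf), fun f hf => ?_, ?_⟩
  · obtain ⟨p, hp, q, hq, hq1, rfl⟩ := (hB f).1 ((hVB f).1 ((V.valuation_le_one_iff f).1 hf.le))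
    rw [map_div₀, hq1, div_one] at hf
    obtain ⟨q', hq', hq1', g, hg, h⟩ := hgen p hp hf
    have hq0 : q ≠ 0 := fun h0 => by simp [h0] at hq1
    have hq0' : q' ≠ 0 := fun h0 => by simp [h0] at hq1'
    refine ⟨g / (q * q'), ?_, ?_⟩
    · rw [← V.valuation_le_one_iff, map_div₀, map_mul, hq1, hq1', mul_one, div_one]
      exact (V.valuation_le_one_iff _).2 (hAV g hg)
    · field_simp
      linear_combination h
  have hV : V = ValuationSubring.ofSubring B.toSubring hmem := ValuationSubring.ext _ _ hVB
  rw [hV]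
  exact hDVR

/-- A regular function on the affine plane curve with coordinate functions `u` and `v` is
congruent to a constant modulo the ideal of the point `(a, b)`. -/
theorem exists_eq_algebraMap_add_of_mem_adjoin_pair {u v : E} (a b : L) {f : E}
    (hf : f ∈ Algebra.adjoin L {u, v}) :
    ∃ c : L, ∃ g ∈ Algebra.adjoin L {u, v}, ∃ h ∈ Algebra.adjoin L {u, v},
      f = algebraMap L E c + g * (u - algebraMap L E a) + h * (v - algebraMap L E b) := by
  have hA : ∀ c : L, algebraMap L E c ∈ Algebra.adjoin L {u, v} := Subalgebra.algebraMap_mem _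
  have hu : u ∈ Algebra.adjoin L {u, v} := Algebra.subset_adjoin (by simp)
  have hv : v ∈ Algebra.adjoin L {u, v} := Algebra.subset_adjoin (by simp)
  induction hf using Algebra.adjoin_induction with
  | mem x hx =>
    obtain rfl | rfl := hx
    · exact ⟨a, 1, one_mem _, 0, zero_mem _, by ring⟩
    · exact ⟨b, 0, zero_mem _, 1, one_mem _, by ring⟩
  | algebraMap c => exact ⟨c, 0, zero_mem _, 0, zero_mem _, by ring⟩
  | add x y _ _ hx hy =>
    obtain ⟨c, g, hg, h, hh, rfl⟩ := hx
    obtain ⟨c', g', hg', h', hh', rfl⟩ := hy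
    exact ⟨c + c', g + g', add_mem hg hg', h + h', add_mem hh hh', by rw [map_add]; ring⟩
  | mul x y _ hyA hx hy =>
    obtain ⟨c, g, hg, h, hh, rfl⟩ := hx
    obtain ⟨c', g', hg', h', hh', hy'⟩ := hy
    refine ⟨c * c', algebraMap L E c * g' + g * y, add_mem (mul_mem (hA _) hg') (mul_mem hg hyA),
      algebraMap L E c * h' + h * y, add_mem (mul_mem (hA _) hh') (mul_mem hh hyA), ?_⟩
    rw [map_mul]
    linear_combination algebraMap L E c * hy'

theorem adjoin_pair_mem {V : ValuationSubring E} (hV : ∀ a : L, algebraMap L E a ∈ V) {u v : E}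
    {a b : L} (hu : V.valuation (u - algebraMap L E a) < 1)
    (hv : V.valuation (v - algebraMap L E b) < 1) {f : E} (hf : f ∈ Algebra.adjoin L {u, v}) :
    f ∈ V := by
  refine adjoin_subset hV ?_ hf
  have key : ∀ (w : E) (c : L), V.valuation (w - algebraMap L E c) < 1 → w ∈ V := fun w c h => by
    have := V.add_mem _ _ ((V.valuation_le_one_iff _).1 h.le) (hV c)
    rwa [sub_add_cancel] at this
  rintro x (rfl | rfl)
  exacts [key _ _ hu, key _ _ hv]

/-- The last two terms lie in the maximal ideal, so `c` is the residue, and a nonzero constant is a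
unit. The criterion depends on the center `(a, b)` only, not on `V`. -/
theorem valuation_lt_one_iff_of_eq_algebraMap_add {V : ValuationSubring E}
    (hV : ∀ a : L, algebraMap L E a ∈ V) {u v : E} {a b : L}
    (hu : V.valuation (u - algebraMap L E a) < 1) (hv : V.valuation (v - algebraMap L E b) < 1)
    {c : L} {g h : E} (hg : g ∈ Algebra.adjoin L {u, v}) (hh : h ∈ Algebra.adjoin L {u, v}) :
    V.valuation (algebraMap L E c + g * (u - algebraMap L E a) + h * (v - algebraMap L E b)) < 1 ↔
      c = 0 := by
  have key : ∀ {w t : E}, w ∈ Algebra.adjoin L {u, v} → V.valuation t < 1 →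
      V.valuation (w * t) < 1 := fun {w t} hw ht => by
    rw [map_mul]
    exact lt_of_le_of_lt (mul_le_of_le_one_left'
      ((V.valuation_le_one_iff w).2 (adjoin_pair_mem hV hu hv hw))) ht
  have hsum : V.valuation (g * (u - algebraMap L E a) + h * (v - algebraMap L E b)) < 1 :=
    V.valuation.map_add_lt (key hg hu) (key hh hv)
  rw [add_assoc]
  constructor
  · intro hlt
    by_contra hc
    have h1 := V.valuation.map_sub_lt hlt hsum
    rw [add_sub_cancel_right, valuation_algebraMap_eq_one hV hc] at h1
    exact lt_irrefl _ h1
  · rintro rfl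
    rwa [map_zero, zero_add]

/-- The local ring of a smooth point `(a, b)` of a plane curve with coordinate functions `u` and
`v` and local parameter `s`. -/
theorem exists_eq_div_of_smooth {V : ValuationSubring E} (hV : ∀ a : L, algebraMap L E a ∈ V)
    {u v : E} (hadj : IntermediateField.adjoin L {u, v} = ⊤) {a b : L}
    (hu : V.valuation (u - algebraMap L E a) < 1) (hv : V.valuation (v - algebraMap L E b) < 1)
    {s : E} (hsA : s ∈ Algebra.adjoin L {u, v}) (hs0 : s ≠ 0) (hs : V.valuation s < 1)
    (hgu : ∃ q ∈ Algebra.adjoin L {u, v}, V.valuation q = 1 ∧ ∃ g ∈ Algebra.adjoin L {u, v},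
      q * (u - algebraMap L E a) = g * s)
    (hgv : ∃ q ∈ Algebra.adjoin L {u, v}, V.valuation q = 1 ∧ ∃ g ∈ Algebra.adjoin L {u, v},
      q * (v - algebraMap L E b) = g * s) :
    (∀ f ∈ V, ∃ p ∈ Algebra.adjoin L {u, v}, ∃ q ∈ Algebra.adjoin L {u, v},
      V.valuation q = 1 ∧ f = p / q) ∧
      (∀ f, V.valuation f < 1 → ∃ g ∈ V, f = g * s) ∧ IsDiscreteValuationRing V := by
  have : IsNoetherianRing (Algebra.adjoin L {u, v}) :=
    isNoetherianRing_of_fg (Subalgebra.fg_def.2 ⟨{u, v}, Set.toFinite _, rfl⟩)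
  have : IsFractionRing (Algebra.adjoin L {u, v}) E := by
    refine .of_field _ _ fun f => ?_
    have hf : f ∈ IntermediateField.adjoin L {u, v} := hadj ▸ IntermediateField.mem_top
    obtain ⟨p, hp, q, hq, h⟩ := IntermediateField.mem_adjoin_iff_div.mp hf
    exact ⟨⟨p, hp⟩, ⟨q, hq⟩, h⟩
  refine exists_eq_div_and_isDiscreteValuationRing (fun f => adjoin_pair_mem hV hu hv) hsA hs0 hs ?_
  intro f hf hlt
  obtain ⟨c, g, hg, h, hh, rfl⟩ := exists_eq_algebraMap_add_of_mem_adjoin_pair a b hf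
  obtain rfl := (valuation_lt_one_iff_of_eq_algebraMap_add hV hu hv hg hh).1 hlt
  obtain ⟨q₁, hq₁, hq₁', g₁, hg₁, h₁⟩ := hgu
  obtain ⟨q₂, hq₂, hq₂', g₂, hg₂, h₂⟩ := hgv
  refine ⟨q₁ * q₂, mul_mem hq₁ hq₂, by rw [map_mul, hq₁', hq₂', mul_one],
    g * q₂ * g₁ + h * q₁ * g₂,
    add_mem (mul_mem (mul_mem hg hq₂) hg₁) (mul_mem (mul_mem hh hq₁) hg₂), ?_⟩
  rw [map_zero]
  linear_combination g * q₂ * h₁ + h * q₁ * h₂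

/-- A valuation ring that is the local ring of a smooth point is determined by the point. -/
theorem eq_of_center_eq {V V' : ValuationSubring E} (hV : ∀ a : L, algebraMap L E a ∈ V)
    (hV' : ∀ a : L, algebraMap L E a ∈ V') {u v : E} {a b : L}
    (hu : V.valuation (u - algebraMap L E a) < 1) (hv : V.valuation (v - algebraMap L E b) < 1)
    (hu' : V'.valuation (u - algebraMap L E a) < 1) (hv' : V'.valuation (v - algebraMap L E b) < 1)
    (hloc : ∀ f ∈ V, ∃ p ∈ Algebra.adjoin L {u, v}, ∃ q ∈ Algebra.adjoin L {u, v},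
      V.valuation q = 1 ∧ f = p / q)
    (hloc' : ∀ f ∈ V', ∃ p ∈ Algebra.adjoin L {u, v}, ∃ q ∈ Algebra.adjoin L {u, v},
      V'.valuation q = 1 ∧ f = p / q) : V = V' := by
  have key : ∀ {W W' : ValuationSubring E}, (∀ a : L, algebraMap L E a ∈ W) →
      (∀ a : L, algebraMap L E a ∈ W') →
      W.valuation (u - algebraMap L E a) < 1 → W.valuation (v - algebraMap L E b) < 1 →
      W'.valuation (u - algebraMap L E a) < 1 → W'.valuation (v - algebraMap L E b) < 1 →
      (∀ f ∈ W, ∃ p ∈ Algebra.adjoin L {u, v}, ∃ q ∈ Algebra.adjoin L {u, v},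
        W.valuation q = 1 ∧ f = p / q) → W ≤ W' := by
    intro W W' hW hW' hu hv hu' hv' hl f hf
    obtain ⟨p, hp, q, hq, hq1, rfl⟩ := hl f hf
    -- The residue of `q` at `(a, b)` is the same constant for both rings, so a unit of `W` in the
    -- coordinate ring is also a unit of `W'`.
    have hq1' : W'.valuation q = 1 := by
      refine le_antisymm ((W'.valuation_le_one_iff _).2 (adjoin_pair_mem hW' hu' hv' hq)) ?_
      obtain ⟨c, g, hg, h, hh, rfl⟩ := exists_eq_algebraMap_add_of_mem_adjoin_pair a b hq
      by_contra hlt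
      have hc := (valuation_lt_one_iff_of_eq_algebraMap_add hW' hu' hv' hg hh).1 (not_le.1 hlt)
      exact hq1.not_lt ((valuation_lt_one_iff_of_eq_algebraMap_add hW hu hv hg hh).2 hc)
    rw [← W'.valuation_le_one_iff, map_div₀, hq1', div_one]
    exact (W'.valuation_le_one_iff _).2 (adjoin_pair_mem hW' hu' hv' hp)
  exact le_antisymm (key hV hV' hu hv hu' hv' hloc) (key hV' hV hu' hv' hu hv hloc')

/-- A function that is not algebraic over the constants has a pole. -/
theorem exists_notMem_of_not_isIntegral {f : E} (hf : ¬ IsIntegral L f) :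
    ∃ V : ValuationSubring E, (∀ a : L, algebraMap L E a ∈ V) ∧ f ∉ V := by
  by_contra! hcon
  -- The integral closure of a subring in a field is the intersection of the valuation rings that
  -- contain the subring.
  have h := iInf_valuationSubring_superset (K := E) (s := Set.range (algebraMap L E))
  have hmem : f ∈ (integralClosure (Subring.closure (Set.range (algebraMap L E))) E).toSubring := by
    rw [← h, Subring.mem_iInf]
    exact fun V => hcon V.1 fun a => V.2 ⟨a, rfl⟩
  have hint : IsIntegral (Subring.closure (Set.range (algebraMap L E))) f := hmem
  refine hf ?_
  -- The subring generated by the constants consists of constants, so the monic equation of `f`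
  -- lifts to `L`.
  have hle : Subring.closure (Set.range (algebraMap L E)) ≤ (algebraMap L E).range :=
    Subring.closure_le.2 fun x hx => hx
  obtain ⟨p, hp, hpf⟩ := hint
  have hlift : p.map (Subring.subtype _) ∈ Polynomial.lifts (algebraMap L E) := by
    rw [Polynomial.lifts_iff_coeff_lifts]
    exact fun n => by
      rw [Polynomial.coeff_map]
      exact hle (p.coeff n).2
  obtain ⟨q, hq, -, hqm⟩ := Polynomial.lifts_and_natDegree_eq_and_monic hlift (hp.map _)
  refine ⟨q, hqm, ?_⟩
  rw [← Polynomial.eval_map, hq, Polynomial.eval_map]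
  exact hpf

end PlaneCurve

/-! ### Orders of functions, and the structure of the function field -/

namespace SuperellipticCurve

noncomputable section

variable {k : Type u} [Field k] {C : SuperellipticCurve k}

namespace Point

variable (P : C.Point)

theorem ord_pow {f : C.FunctionField} (hf : f ≠ 0) (n : ℕ) : P.ord (f ^ n) = n * P.ord f := by
  induction n with
  | zero => simp [P.ord_one]
  | succ n ih =>
    rw [pow_succ, P.ord_mul (pow_ne_zero n hf) hf, ih]
    push_cast
    ring

theorem ord_zpow {f : C.FunctionField} (hf : f ≠ 0) (n : ℤ) : P.ord (f ^ n) = n * P.ord f := by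
  obtain ⟨n, rfl | rfl⟩ := n.eq_nat_or_neg
  · rw [zpow_natCast, P.ord_pow hf]
  · rw [zpow_neg, zpow_natCast, P.ord_inv, P.ord_pow hf]
    ring

theorem ord_div {f g : C.FunctionField} (hf : f ≠ 0) (hg : g ≠ 0) :
    P.ord (f / g) = P.ord f - P.ord g := by
  rw [div_eq_mul_inv, P.ord_mul hf (inv_ne_zero hg), P.ord_inv, sub_eq_add_neg]

theorem ord_prod {ι : Type*} (s : Finset ι) {f : ι → C.FunctionField} (hf : ∀ i ∈ s, f i ≠ 0) :
    P.ord (∏ i ∈ s, f i) = ∑ i ∈ s, P.ord (f i) := by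
  classical
  induction s using Finset.induction_on with
  | empty => simp [P.ord_one]
  | insert i s hi ih =>
    rw [Finset.prod_insert hi, Finset.sum_insert hi, P.ord_mul (hf i (by simp))
      (Finset.prod_ne_zero_iff.2 fun j hj => hf j (by simp [hj])),
      ih fun j hj => hf j (by simp [hj])]

/-- Passes from the valuation of the subring, whose value group is abstract, to the integer-valued
order: both detect the maximal ideal. -/
theorem ord_pos {f : C.FunctionField} (hf0 : f ≠ 0) (hf : P.localRing.valuation f < 1) :
    0 < P.ord f := by
  have hmem := (P.localRing.valuation_le_one_iff f).1 hf.le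
  have hlt := ((IsDiscreteValuationRing.maximalIdeal P.localRing).valuation_lt_one_iff_mem
    (K := C.FunctionField) ⟨f, hmem⟩).2 ((P.localRing.valuation_lt_one_iff ⟨f, hmem⟩).2 hf)
  have h0 := (Valuation.ne_zero_iff
    ((IsDiscreteValuationRing.maximalIdeal P.localRing).valuation C.FunctionField)).2 hf0
  have := (WithZero.log_lt_log h0 one_ne_zero).2 hlt
  rw [WithZero.log_one] at this
  rw [ord]
  omega

theorem ord_eq_zero {f : C.FunctionField} (hf : P.localRing.valuation f = 1) : P.ord f = 0 := by
  have hmem := (P.localRing.valuation_le_one_iff f).1 hf.le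
  have hnot : (⟨f, hmem⟩ : P.localRing) ∉
      (IsDiscreteValuationRing.maximalIdeal P.localRing).asIdeal :=
    fun h => ((P.localRing.valuation_lt_one_iff ⟨f, hmem⟩).1 h).ne hf
  have h1 : (IsDiscreteValuationRing.maximalIdeal P.localRing).valuation C.FunctionField f = 1 :=
    ((IsDiscreteValuationRing.maximalIdeal P.localRing).valuation_eq_one_iff_notMem
      (K := C.FunctionField)).2 hnot
  rw [ord, h1, WithZero.log_one, neg_zero]

theorem ord_neg {f : C.FunctionField} (hf : f ∉ P.localRing) : P.ord f < 0 := by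
  have hf0 : f ≠ 0 := fun h => hf (h ▸ P.localRing.zero_mem)
  have hlt : 1 < P.localRing.valuation f := by
    rwa [← not_le, P.localRing.valuation_le_one_iff]
  have := P.ord_pos (inv_ne_zero hf0) (by rw [map_inv₀]; exact inv_lt_one_of_one_lt₀ hlt)
  rw [P.ord_inv] at this
  omega

/-- The criterion for a local parameter: `s` generates the maximal ideal, and the adic valuation of
a generator is `exp (-1)`. -/
theorem ord_eq_one {s : C.FunctionField} (hs0 : s ≠ 0) (hs : P.localRing.valuation s < 1)
    (hgen : ∀ f, P.localRing.valuation f < 1 → ∃ g ∈ P.localRing, f = g * s) : P.ord s = 1 := by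
  have hmem := (P.localRing.valuation_le_one_iff s).1 hs.le
  have hspan : (IsDiscreteValuationRing.maximalIdeal P.localRing).asIdeal =
      Ideal.span {(⟨s, hmem⟩ : P.localRing)} := by
    apply le_antisymm
    · intro f hf
      obtain ⟨g, hg, h⟩ := hgen f ((P.localRing.valuation_lt_one_iff f).1 hf)
      exact Ideal.mem_span_singleton'.2 ⟨⟨g, hg⟩, Subtype.ext h.symm⟩
    · rw [Ideal.span_singleton_le_iff_mem]
      exact (P.localRing.valuation_lt_one_iff ⟨s, hmem⟩).2 hs
  have h1 : (IsDiscreteValuationRing.maximalIdeal P.localRing).valuation C.FunctionField s =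
      WithZero.exp (-1 : ℤ) := by
    have h2 := (IsDiscreteValuationRing.maximalIdeal P.localRing).intValuation_singleton
      (r := ⟨s, hmem⟩) (fun h => hs0 (congrArg Subtype.val h)) hspan
    rw [← h2]
    exact (IsDiscreteValuationRing.maximalIdeal P.localRing).valuation_of_algebraMap
      (K := C.FunctionField) ⟨s, hmem⟩
  rw [ord, h1, WithZero.log_exp, neg_neg]

end Point

/-- The function `x` in the function field. -/
def x (C : SuperellipticCurve k) : C.FunctionField :=
  algebraMap C.CoordinateRing C.FunctionField C.xCoord

/-- The function `y` in the function field. -/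
def y (C : SuperellipticCurve k) : C.FunctionField :=
  algebraMap C.CoordinateRing C.FunctionField C.yCoord

theorem m_pos : 0 < C.m := by have := C.two_le_m; omega

theorem of_eq_aeval (p : Polynomial k) :
    AdjoinRoot.of C.equation p = Polynomial.aeval C.xCoord p := by
  have h : (AdjoinRoot.of C.equation : Polynomial k →+* C.CoordinateRing) =
      (Polynomial.aeval C.xCoord : Polynomial k →ₐ[k] C.CoordinateRing) := by
    refine Polynomial.ringHom_ext (fun a => ?_) ?_
    · simp
      rfl
    · simp [xCoord]
  exact congrArg (fun φ : Polynomial k →+* C.CoordinateRing => φ p) h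

theorem algebraMap_of (p : Polynomial k) :
    algebraMap C.CoordinateRing C.FunctionField (AdjoinRoot.of C.equation p) =
      Polynomial.aeval C.x p := by
  rw [of_eq_aeval, x, Polynomial.aeval_algebraMap_apply]

theorem of_injective : Function.Injective (AdjoinRoot.of C.equation) :=
  AdjoinRoot.of.injective_of_degree_ne_zero fun h0 => by
    have h1 := C.natDegree_equation
    have h2 : C.equation.natDegree = 0 := Polynomial.natDegree_eq_of_degree_eq_some h0
    have := C.m_pos
    omega

theorem aeval_x_eq_zero_iff {p : Polynomial k} : Polynomial.aeval C.x p = 0 ↔ p = 0 := by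
  rw [← algebraMap_of, map_eq_zero_iff _ (IsFractionRing.injective _ _),
    map_eq_zero_iff _ of_injective]

theorem y_pow : C.y ^ C.m = Polynomial.aeval C.x C.F := by
  rw [← algebraMap_of, ← C.yCoord_pow, map_pow, y]

theorem y_ne_zero : C.y ≠ 0 := by
  rw [y, Ne, map_eq_zero_iff _ (IsFractionRing.injective _ _)]
  exact C.yCoord_ne_zero

theorem x_sub_ne_zero (a : k) : C.x - algebraMap k C.FunctionField a ≠ 0 := by
  have h := (aeval_x_eq_zero_iff (C := C) (p := Polynomial.X - Polynomial.C a)).not.2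
    (Polynomial.X_sub_C_ne_zero a)
  simpa using h

theorem x_ne_zero : C.x ≠ 0 := by simpa using x_sub_ne_zero (C := C) 0

/-- Every function is a polynomial in `y` with coefficients polynomials in `x`, divided by a
polynomial in `x`. -/
theorem exists_eq_sum_div (f : C.FunctionField) :
    ∃ (p : ℕ → Polynomial k) (q : Polynomial k), q ≠ 0 ∧
      f = (∑ j ∈ Finset.range C.m, Polynomial.aeval C.x (p j) * C.y ^ j) /
        Polynomial.aeval C.x q := by
  have hmod : ∀ n : C.CoordinateRing, ∃ p : ℕ → Polynomial k,
      algebraMap C.CoordinateRing C.FunctionField n =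
        ∑ j ∈ Finset.range C.m, Polynomial.aeval C.x (p j) * C.y ^ j := by
    intro n
    obtain ⟨g, rfl⟩ := AdjoinRoot.mk_surjective n
    have hg : AdjoinRoot.mk C.equation g = AdjoinRoot.mk C.equation (g %ₘ C.equation) := by
      conv_lhs => rw [← Polynomial.modByMonic_add_div g C.equation]
      rw [map_add, map_mul, AdjoinRoot.mk_self, zero_mul, add_zero]
    have hdeg : (g %ₘ C.equation).natDegree < C.m := by
      have := Polynomial.natDegree_modByMonic_lt g C.equation_monic fun h => by
        have h1 := C.natDegree_equation
        rw [h, Polynomial.natDegree_one] at h1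
        have := C.m_pos
        omega
      rwa [C.natDegree_equation] at this
    refine ⟨(g %ₘ C.equation).coeff, ?_⟩
    rw [hg]
    conv_lhs => rw [Polynomial.as_sum_range' _ _ hdeg]
    rw [map_sum, map_sum]
    refine Finset.sum_congr rfl fun j _ => ?_
    rw [← Polynomial.C_mul_X_pow_eq_monomial, map_mul, map_pow, AdjoinRoot.mk_X,
      AdjoinRoot.mk_C, map_mul, map_pow, algebraMap_of]
    rfl
  obtain ⟨n, d, hd, rfl⟩ := IsFractionRing.div_surjective (A := C.CoordinateRing) f
  have hd0 : d ≠ 0 := nonZeroDivisors.ne_zero hd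
  have hint : IsIntegral (Polynomial k) d := by
    have : Module.Finite (Polynomial k) C.CoordinateRing := C.equation_monic.finite_adjoinRoot
    exact Algebra.IsIntegral.isIntegral d
  -- The coordinate ring is integral over k[x], so the ideal `(d)` contains a nonzero polynomial `q
  -- = e d` in `x`, and `n / d = n e / q`.
  have hbot := Ideal.comap_ne_bot_of_integral_mem (I := Ideal.span {d}) hd0
    (Ideal.mem_span_singleton_self d) hint
  obtain ⟨q, hq, hq0⟩ := (Submodule.ne_bot_iff _).1 hbot
  obtain ⟨e, he⟩ := Ideal.mem_span_singleton'.1 (Ideal.mem_comap.1 hq)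
  obtain ⟨p, hp⟩ := hmod (n * e)
  refine ⟨p, q, hq0, ?_⟩
  have hq' : Polynomial.aeval C.x q = algebraMap C.CoordinateRing C.FunctionField e *
      algebraMap C.CoordinateRing C.FunctionField d := by
    rw [← algebraMap_of, ← map_mul, he]
    rfl
  have hde : algebraMap C.CoordinateRing C.FunctionField e ≠ 0 := by
    intro h
    rw [h, zero_mul] at hq'
    exact hq0 (aeval_x_eq_zero_iff.1 hq')
  rw [← hp, hq', map_mul, mul_comm, mul_div_mul_left _ _ hde]

theorem adjoin_x_y : IntermediateField.adjoin k {C.x, C.y} = ⊤ := by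
  rw [eq_top_iff]
  intro f _
  obtain ⟨p, q, -, rfl⟩ := exists_eq_sum_div f
  have hy : C.y ∈ IntermediateField.adjoin k {C.x, C.y} :=
    IntermediateField.subset_adjoin _ _ (by simp)
  have hp : ∀ p : Polynomial k, Polynomial.aeval C.x p ∈ IntermediateField.adjoin k {C.x, C.y} :=
    fun p => IntermediateField.algebra_adjoin_le_adjoin _ _
      (Algebra.adjoin_mono (by simp) (Polynomial.aeval_mem_adjoin_singleton k C.x))
  exact div_mem (sum_mem fun j _ => mul_mem (hp _) (pow_mem hy j)) (hp q)

/-- Linear independence of 1, y, ..., y^(m-1) over k[x]: the monic equation of degree `m` divides no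
nonzero polynomial of smaller degree in `y`. -/
theorem eq_zero_of_sum_eq_zero {p : ℕ → Polynomial k}
    (h : ∑ j ∈ Finset.range C.m, Polynomial.aeval C.x (p j) * C.y ^ j = 0) {j : ℕ} (hj : j < C.m) :
    p j = 0 := by
  let g : Polynomial (Polynomial k) := ∑ j ∈ Finset.range C.m, Polynomial.C (p j) * Polynomial.X ^ j
  have hg : AdjoinRoot.mk C.equation g = 0 := by
    apply IsFractionRing.injective C.CoordinateRing C.FunctionField
    rw [map_zero, ← h, map_sum, map_sum]
    refine Finset.sum_congr rfl fun j _ => ?_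
    rw [map_mul, map_pow, AdjoinRoot.mk_X, AdjoinRoot.mk_C, map_mul, map_pow, algebraMap_of]
    rfl
  have hcoeff : ∀ n, g.coeff n = if n < C.m then p n else 0 := fun n => by
    simp [g, Polynomial.finsetSum_coeff, Polynomial.coeff_C_mul, Polynomial.coeff_X_pow]
  have hg0 : g = 0 := by
    by_contra hne
    refine C.equation_monic.not_dvd_of_natDegree_lt hne ?_ (AdjoinRoot.mk_eq_zero.1 hg)
    rw [C.natDegree_equation, Polynomial.natDegree_lt_iff_degree_lt hne,
      Polynomial.degree_lt_iff_coeff_zero]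
    intro n hn
    rw [hcoeff, if_neg (by omega)]
  have := hcoeff j
  rw [hg0, if_pos hj, Polynomial.coeff_zero] at this
  exact this.symm

/-- The endomorphism `(x, y) ↦ (x, ω y)` of the coordinate ring. -/
def scaleCoordinateRing {ω : k} (hω : ω ^ C.m = 1) : C.CoordinateRing →+* C.CoordinateRing :=
  AdjoinRoot.lift (AdjoinRoot.of C.equation)
    (AdjoinRoot.of C.equation (Polynomial.C ω) * C.yCoord) (by
      change Polynomial.eval₂ _ _ (Polynomial.X ^ C.m - Polynomial.C C.F) = 0
      rw [Polynomial.eval₂_sub, Polynomial.eval₂_pow, Polynomial.eval₂_X, Polynomial.eval₂_C,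
        mul_pow, ← map_pow, ← map_pow, hω, map_one, map_one, one_mul, C.yCoord_pow, sub_self])

theorem scaleCoordinateRing_of {ω : k} (hω : ω ^ C.m = 1) (p : Polynomial k) :
    scaleCoordinateRing hω (AdjoinRoot.of C.equation p) = AdjoinRoot.of C.equation p :=
  AdjoinRoot.lift_of _

theorem scaleCoordinateRing_yCoord {ω : k} (hω : ω ^ C.m = 1) :
    scaleCoordinateRing hω C.yCoord = AdjoinRoot.of C.equation (Polynomial.C ω) * C.yCoord :=
  AdjoinRoot.lift_root _

theorem scaleCoordinateRing_injective {ω : k} (hω : ω ^ C.m = 1) :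
    Function.Injective (scaleCoordinateRing hω) := by
  have hω0 : ω ≠ 0 := by
    rintro rfl
    rw [zero_pow C.m_pos.ne'] at hω
    exact zero_ne_one hω
  have hω' : ω⁻¹ ^ C.m = 1 := by rw [inv_pow, hω, inv_one]
  -- Scaling by `ω⁻¹` is a left inverse.
  have hid : (scaleCoordinateRing hω').comp (scaleCoordinateRing hω) =
      RingHom.id C.CoordinateRing := by
    refine AdjoinRoot.ringHom_ext (RingHom.ext fun p => ?_) ?_
    · simp only [RingHom.comp_apply, scaleCoordinateRing_of, RingHom.id_apply]
    · change scaleCoordinateRing hω' (scaleCoordinateRing hω C.yCoord) = C.yCoord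
      rw [scaleCoordinateRing_yCoord, map_mul, scaleCoordinateRing_of, scaleCoordinateRing_yCoord,
        ← mul_assoc, ← map_mul, ← map_mul, mul_inv_cancel₀ hω0, map_one, map_one, one_mul]
  exact Function.LeftInverse.injective (g := scaleCoordinateRing hω')
    fun f => congrArg (fun φ : C.CoordinateRing →+* C.CoordinateRing => φ f) hid

/-- The function field has an endomorphism `(x, y) ↦ (x, ω y)` for every `m`-th root of unity. -/
theorem exists_scale {ω : k} (hω : ω ^ C.m = 1) :
    ∃ σ : C.FunctionField →ₐ[k] C.FunctionField, σ C.x = C.x ∧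
      σ C.y = algebraMap k C.FunctionField ω * C.y := by
  have hinj : Function.Injective
      ((algebraMap C.CoordinateRing C.FunctionField).comp (scaleCoordinateRing hω)) :=
    (IsFractionRing.injective C.CoordinateRing C.FunctionField).comp
      (scaleCoordinateRing_injective hω)
  have hlift : ∀ f : C.CoordinateRing, IsFractionRing.lift (K := C.FunctionField) hinj
      (algebraMap C.CoordinateRing C.FunctionField f) =
        algebraMap C.CoordinateRing C.FunctionField (scaleCoordinateRing hω f) :=
    fun f => IsFractionRing.lift_algebraMap hinj f
  have hconst : ∀ a : k, algebraMap C.CoordinateRing C.FunctionField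
      (AdjoinRoot.of C.equation (Polynomial.C a)) = algebraMap k C.FunctionField a := fun a => by
    rw [algebraMap_of, Polynomial.aeval_C]
  refine ⟨⟨IsFractionRing.lift (K := C.FunctionField) hinj, fun a => ?_⟩, ?_, ?_⟩
  · change IsFractionRing.lift (K := C.FunctionField) hinj _ = _
    rw [← hconst, hlift, scaleCoordinateRing_of]
  · change IsFractionRing.lift (K := C.FunctionField) hinj _ = _
    rw [x, hlift, xCoord, scaleCoordinateRing_of]
  · change IsFractionRing.lift (K := C.FunctionField) hinj _ = _
    rw [y, hlift, scaleCoordinateRing_yCoord, map_mul, hconst]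

end

end SuperellipticCurve

/-! ### Residues of polynomials at a place -/

namespace PlaneCurve

variable {L E : Type*} [Field L] [Field E] [Algebra L E]

/-- `X - a` divides `p - p(a)`, and the cofactor evaluated at `f` stays in `V`. -/
theorem valuation_aeval_sub_lt_one {V : ValuationSubring E} (hV : ∀ a : L, algebraMap L E a ∈ V)
    {f : E} {a : L} (hf : V.valuation (f - algebraMap L E a) < 1) (p : Polynomial L) :
    V.valuation (Polynomial.aeval f p - algebraMap L E (p.eval a)) < 1 := by
  have hfV : f ∈ V := by
    have := V.add_mem _ _ ((V.valuation_le_one_iff _).1 hf.le) (hV a)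
    rwa [sub_add_cancel] at this
  obtain ⟨q, hq⟩ := Polynomial.X_sub_C_dvd_sub_C_eval (a := a) (p := p)
  have h := congrArg (Polynomial.aeval f) hq
  rw [map_sub, map_mul, map_sub, Polynomial.aeval_C, Polynomial.aeval_C, Polynomial.aeval_X] at h
  rw [h, mul_comm, map_mul]
  exact lt_of_le_of_lt (mul_le_of_le_one_left'
    ((V.valuation_le_one_iff _).2 (aeval_mem hV hfV q))) hf

theorem eq_zero_of_valuation_algebraMap_lt_one {V : ValuationSubring E}
    (hV : ∀ a : L, algebraMap L E a ∈ V) {a : L} (h : V.valuation (algebraMap L E a) < 1) :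
    a = 0 := by
  by_contra ha
  exact h.ne (valuation_algebraMap_eq_one hV ha)

theorem eq_of_valuation_sub_lt_one {V : ValuationSubring E} (hV : ∀ a : L, algebraMap L E a ∈ V)
    {f : E} {a b : L} (ha : V.valuation (f - algebraMap L E a) < 1)
    (hb : V.valuation (f - algebraMap L E b) < 1) : a = b := by
  have h := V.valuation.map_sub_lt hb ha
  rw [sub_sub_sub_cancel_left, ← map_sub] at h
  exact sub_eq_zero.1 (eq_zero_of_valuation_algebraMap_lt_one hV h)

theorem valuation_eq_one_of_sub_lt_one {V : ValuationSubring E}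
    (hV : ∀ a : L, algebraMap L E a ∈ V) {f : E} {a : L} (ha : a ≠ 0)
    (h : V.valuation (f - algebraMap L E a) < 1) : V.valuation f = 1 := by
  have hfV : f ∈ V := by
    have := V.add_mem _ _ ((V.valuation_le_one_iff _).1 h.le) (hV a)
    rwa [sub_add_cancel] at this
  refine le_antisymm ((V.valuation_le_one_iff f).2 hfV) (not_lt.1 fun hlt => ha ?_)
  have h0 : V.valuation (f - algebraMap L E 0) < 1 := by rwa [map_zero, sub_zero]
  exact eq_of_valuation_sub_lt_one hV h h0

theorem valuation_aeval_eq_one {V : ValuationSubring E} (hV : ∀ a : L, algebraMap L E a ∈ V)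
    {f : E} {a : L} (hf : V.valuation (f - algebraMap L E a) < 1) {p : Polynomial L}
    (hp : p.eval a ≠ 0) : V.valuation (Polynomial.aeval f p) = 1 :=
  valuation_eq_one_of_sub_lt_one hV hp (valuation_aeval_sub_lt_one hV hf p)

theorem valuation_lt_one_iff_inv_notMem {V : ValuationSubring E} {f : E} (hf : f ≠ 0) :
    V.valuation f < 1 ↔ f⁻¹ ∉ V := by
  have h0 : 0 < V.valuation f := zero_lt_iff.2 ((Valuation.ne_zero_iff _).2 hf)
  rw [← V.valuation_le_one_iff, map_inv₀, not_le, one_lt_inv₀ h0]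

/-- The cofactor `q`, being nonzero at the root, supplies the unit multipliers that
`exists_eq_div_of_smooth` asks for; this is where smoothness enters. -/
theorem exists_eq_mul_of_separable {p : Polynomial L} (hp : p.Separable) {a : L}
    (ha : p.IsRoot a) : ∃ q : Polynomial L, p = (Polynomial.X - Polynomial.C a) * q ∧
      q.eval a ≠ 0 := by
  obtain ⟨q, hq⟩ := Polynomial.dvd_iff_isRoot.2 ha
  refine ⟨q, hq, fun h => ?_⟩
  obtain ⟨g, hg⟩ := Polynomial.dvd_iff_isRoot.2 h
  exact (Polynomial.not_isUnit_X_sub_C a) (hp.squarefree _ ⟨g, by rw [hq, hg]; ring⟩)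

end PlaneCurve

namespace SuperellipticCurve

open PlaneCurve

noncomputable section

/-! ### Places over the affine curve -/

section Affine

variable {k : Type u} [Field k] {C : SuperellipticCurve k} {V : ValuationSubring C.FunctionField}

theorem y_mem (hV : ∀ a : k, algebraMap k C.FunctionField a ∈ V) (hx : C.x ∈ V) : C.y ∈ V :=
  mem_of_pow_mem C.m_pos.ne' (by rw [y_pow]; exact aeval_mem hV hx _)

/-- Both sides are the residue of y^m = F(x). -/
theorem pow_eq_eval_of_center (hV : ∀ a : k, algebraMap k C.FunctionField a ∈ V) {a b : k}
    (hx : V.valuation (C.x - algebraMap k C.FunctionField a) < 1)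
    (hy : V.valuation (C.y - algebraMap k C.FunctionField b) < 1) : b ^ C.m = C.F.eval a := by
  have h1 := valuation_aeval_sub_lt_one hV hy (Polynomial.X ^ C.m)
  rw [map_pow, Polynomial.aeval_X, Polynomial.eval_pow, Polynomial.eval_X, y_pow] at h1
  exact eq_of_valuation_sub_lt_one hV h1 (valuation_aeval_sub_lt_one hV hx C.F)

theorem aeval_x_mem_adjoin (p : Polynomial k) :
    Polynomial.aeval C.x p ∈ Algebra.adjoin k {C.x, C.y} :=
  Algebra.adjoin_mono (by simp) (Polynomial.aeval_mem_adjoin_singleton k C.x)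

theorem aeval_y_mem_adjoin (p : Polynomial k) :
    Polynomial.aeval C.y p ∈ Algebra.adjoin k {C.x, C.y} :=
  Algebra.adjoin_mono (by simp) (Polynomial.aeval_mem_adjoin_singleton k C.y)

theorem y_mem_adjoin : C.y ∈ Algebra.adjoin k {C.x, C.y} := Algebra.subset_adjoin (by simp)

/-- The local ring at a ramification point `(a, 0)`, with local parameter `y`. -/
theorem affine_local_of_isRoot (hV : ∀ a : k, algebraMap k C.FunctionField a ∈ V) {a : k}
    (ha : C.F.IsRoot a) (hx : V.valuation (C.x - algebraMap k C.FunctionField a) < 1)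
    (hy : V.valuation (C.y - algebraMap k C.FunctionField 0) < 1) :
    (∀ f ∈ V, ∃ p ∈ Algebra.adjoin k {C.x, C.y}, ∃ q ∈ Algebra.adjoin k {C.x, C.y},
      V.valuation q = 1 ∧ f = p / q) ∧
      (∀ f, V.valuation f < 1 → ∃ g ∈ V, f = g * C.y) ∧ IsDiscreteValuationRing V := by
  obtain ⟨G, hG, hGa⟩ := exists_eq_mul_of_separable C.separable ha
  have hy' := hy
  rw [map_zero, sub_zero] at hy'
  refine exists_eq_div_of_smooth hV adjoin_x_y hx hy y_mem_adjoin y_ne_zero hy' ?_ ?_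
  -- With F = (X - a) G, the relation is G(x) (x - a) = y^(m-1) · y, and G(x) is a unit.
  · refine ⟨_, aeval_x_mem_adjoin G, valuation_aeval_eq_one hV hx hGa, C.y ^ (C.m - 1),
      pow_mem y_mem_adjoin _, ?_⟩
    rw [← pow_succ, Nat.sub_add_cancel C.m_pos, y_pow]
    conv_rhs => rw [hG]
    rw [map_mul, map_sub, Polynomial.aeval_X, Polynomial.aeval_C, mul_comm]
  · exact ⟨1, one_mem _, map_one _, 1, one_mem _, by rw [map_zero, sub_zero]⟩

/-- The local ring at an affine point `(a, b)` with `b ≠ 0`. -/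
theorem affine_local_of_ne_zero (hV : ∀ a : k, algebraMap k C.FunctionField a ∈ V) {a b : k}
    (hb : b ≠ 0) (hx : V.valuation (C.x - algebraMap k C.FunctionField a) < 1)
    (hy : V.valuation (C.y - algebraMap k C.FunctionField b) < 1) :
    IsDiscreteValuationRing V := by
  have hab := pow_eq_eval_of_center hV hx hy
  obtain ⟨Q, hQ, hQb⟩ := exists_eq_mul_of_separable
    (Polynomial.separable_X_pow_sub_C (b ^ C.m) C.m_ne_zero (pow_ne_zero _ hb))
    (a := b) (by simp)
  obtain ⟨H, hH⟩ := Polynomial.X_sub_C_dvd_sub_C_eval (a := a) (p := C.F)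
  refine (exists_eq_div_of_smooth hV adjoin_x_y hx hy (s := C.x - algebraMap k C.FunctionField a)
    (sub_mem (Algebra.subset_adjoin (by simp)) (Subalgebra.algebraMap_mem _ a)) (x_sub_ne_zero a)
    hx ⟨1, one_mem _, map_one _, 1, one_mem _, rfl⟩ ?_).2.2
  -- Q(y) (y - b) = y^m - b^m = F(x) - F(a) = (x - a) H(x), where Q(b) ≠ 0 because `m` is nonzero in
  -- `k` and `b ≠ 0`.
  refine ⟨_, aeval_y_mem_adjoin Q, valuation_aeval_eq_one hV hy hQb, _, aeval_x_mem_adjoin H, ?_⟩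
  have h1 := congrArg (Polynomial.aeval C.y) hQ
  have h2 := congrArg (Polynomial.aeval C.x) hH
  simp only [map_sub, map_mul, map_pow, Polynomial.aeval_X, Polynomial.aeval_C, y_pow] at h1 h2
  rw [← hab, map_pow] at h2
  linear_combination h2 - h1

variable [IsAlgClosed k]

/-- If `x` had no residue in `k`, every nonzero polynomial in `x` would be a unit of `V`; as `y` is
integral over k[x], `V` would be the whole function field. The residue of `y` is then a root of Y^m
- F(a). -/
theorem exists_center (hV : ∀ a : k, algebraMap k C.FunctionField a ∈ V) (htop : V ≠ ⊤)
    (hx : C.x ∈ V) : ∃ a b : k, V.valuation (C.x - algebraMap k C.FunctionField a) < 1 ∧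
      V.valuation (C.y - algebraMap k C.FunctionField b) < 1 := by
  have hy := y_mem hV hx
  have hex : ∃ a : k, V.valuation (C.x - algebraMap k C.FunctionField a) < 1 := by
    by_contra! hcon
    refine htop (eq_top_iff.2 fun f _ => ?_)
    obtain ⟨p, q, hq, rfl⟩ := exists_eq_sum_div f
    have hq1 : V.valuation (Polynomial.aeval C.x q) = 1 := by
      refine le_antisymm ((V.valuation_le_one_iff _).2 (aeval_mem hV hx q)) (not_lt.1 fun h => ?_)
      obtain ⟨a, -, ha⟩ := exists_isRoot_valuation_sub_lt_one hV hq h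
      exact absurd ha (not_lt.2 (hcon a))
    rw [← V.valuation_le_one_iff, map_div₀, hq1, div_one, V.valuation_le_one_iff]
    exact sum_mem fun j _ => mul_mem (aeval_mem hV hx _) (pow_mem hy j)
  obtain ⟨a, ha⟩ := hex
  have h1 := valuation_aeval_sub_lt_one hV ha C.F
  have h2 : V.valuation
      (Polynomial.aeval C.y (Polynomial.X ^ C.m - Polynomial.C (C.F.eval a))) < 1 := by
    rwa [map_sub, map_pow, Polynomial.aeval_X, Polynomial.aeval_C, y_pow]
  obtain ⟨b, -, hb⟩ := exists_isRoot_valuation_sub_lt_one hV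
    (Polynomial.X_pow_sub_C_ne_zero C.m_pos _) h2
  exact ⟨a, b, ha, hb⟩

theorem isDVR_of_x_mem (hV : ∀ a : k, algebraMap k C.FunctionField a ∈ V) (htop : V ≠ ⊤)
    (hx : C.x ∈ V) : IsDiscreteValuationRing V := by
  obtain ⟨a, b, ha, hb⟩ := exists_center hV htop hx
  obtain rfl | hb0 := eq_or_ne b 0
  · have h := pow_eq_eval_of_center hV ha hb
    rw [zero_pow C.m_pos.ne'] at h
    exact (affine_local_of_isRoot hV h.symm ha hb).2.2
  · exact affine_local_of_ne_zero hV hb0 ha hb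

end Affine

/-! ### The plane model near infinity -/

section Infinity

variable {k : Type u} [Field k] {C : SuperellipticCurve k}

theorem r_pos : 0 < C.r := C.natDegree_pos

theorem d_pos : 0 < C.d := Nat.gcd_pos_of_pos_left _ C.m_pos

theorem m_div_d_pos : 0 < C.m / C.d :=
  Nat.div_pos (Nat.gcd_le_left _ C.m_pos) C.d_pos

theorem m_div_d_mul : C.m / C.d * C.d = C.m := Nat.div_mul_cancel (Nat.gcd_dvd_left _ _)

theorem r_div_d_mul : C.r / C.d * C.d = C.r := Nat.div_mul_cancel (Nat.gcd_dvd_right _ _)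

variable (C)

/-- Bézout for the coprime numbers r/d and m/d. At infinity `x` and `y` have orders -m/d and -r/d,
so x^A / y^n has order 1. -/
theorem exists_exponents : ∃ n A : ℕ, n * (C.r / C.d) = A * (C.m / C.d) + 1 := by
  have hco : (C.r / C.d).Coprime (C.m / C.d) := (Nat.coprime_div_gcd_div_gcd C.d_pos).symm
  have hr : 0 < C.r / C.d := Nat.div_pos (Nat.gcd_le_right _ C.r_pos) C.d_pos
  obtain h1 | h1 := (Nat.succ_le_of_lt C.m_div_d_pos).eq_or_lt
  -- The case m/d = 1 is separate, since no residue modulo 1 equals 1.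
  · exact ⟨1, C.r / C.d - 1, by rw [← h1]; omega⟩
  · obtain ⟨n, -, hn⟩ := Nat.exists_mul_mod_eq_one_of_coprime hco h1
    refine ⟨n, C.r / C.d * n / (C.m / C.d), ?_⟩
    have := Nat.div_add_mod (C.r / C.d * n) (C.m / C.d)
    rw [hn] at this
    rw [mul_comm n, mul_comm _ (C.m / C.d), this]

/-- The function `y ^ (m / d) / x ^ (r / d)`, which separates the points at infinity. -/
def zInf : C.FunctionField := C.y ^ (C.m / C.d) / C.x ^ (C.r / C.d)

/-- The exponent of `y⁻¹` in the local parameter at infinity. -/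
def expY : ℕ := C.exists_exponents.choose

/-- The exponent of `x` in the local parameter at infinity. -/
def expX : ℕ := C.exists_exponents.choose_spec.choose

theorem expY_mul : C.expY * (C.r / C.d) = C.expX * (C.m / C.d) + 1 :=
  C.exists_exponents.choose_spec.choose_spec

/-- The local parameter at the points at infinity. -/
def sInf : C.FunctionField := C.x ^ C.expX / C.y ^ C.expY

variable {C}

theorem zInf_ne_zero : C.zInf ≠ 0 := div_ne_zero (pow_ne_zero _ y_ne_zero) (pow_ne_zero _ x_ne_zero)

theorem sInf_ne_zero : C.sInf ≠ 0 := div_ne_zero (pow_ne_zero _ x_ne_zero) (pow_ne_zero _ y_ne_zero)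

/-- The power of `y` cancels, and the exponent relation leaves x^(-1). With `y_inv_eq` this shows
that `s` and `z` generate the function field. -/
theorem x_inv_eq : C.x⁻¹ = C.sInf ^ (C.m / C.d) * C.zInf ^ C.expY := by
  have hx := C.x_ne_zero
  have hy := C.y_ne_zero
  have h := C.expY_mul
  rw [sInf, zInf, div_pow, div_pow, ← pow_mul, ← pow_mul, ← pow_mul, ← pow_mul,
    mul_comm (C.r / C.d), h, pow_succ, mul_comm C.expY]
  field_simp

theorem y_inv_eq : C.y⁻¹ = C.sInf ^ (C.r / C.d) * C.zInf ^ C.expX := by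
  have hx := C.x_ne_zero
  have hy := C.y_ne_zero
  have h := C.expY_mul
  rw [sInf, zInf, div_pow, div_pow, ← pow_mul, ← pow_mul, ← pow_mul, ← pow_mul,
    mul_comm (C.r / C.d), h, pow_succ, mul_comm C.expX (C.m / C.d)]
  field_simp

theorem adjoin_sInf_zInf : IntermediateField.adjoin k {C.sInf, C.zInf} = ⊤ := by
  rw [eq_top_iff, ← adjoin_x_y, IntermediateField.adjoin_le_iff]
  have hs : C.sInf ∈ IntermediateField.adjoin k {C.sInf, C.zInf} :=
    IntermediateField.subset_adjoin _ _ (by simp)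
  have hz : C.zInf ∈ IntermediateField.adjoin k {C.sInf, C.zInf} :=
    IntermediateField.subset_adjoin _ _ (by simp)
  rintro f (rfl | rfl)
  · rw [← inv_inv C.x, x_inv_eq]
    exact inv_mem (mul_mem (pow_mem hs _) (pow_mem hz _))
  · rw [← inv_inv C.y, y_inv_eq]
    exact inv_mem (mul_mem (pow_mem hs _) (pow_mem hz _))

/-- z^d = y^m / x^r = F(x) / x^r, which is the reversed polynomial at 1/x. Its constant term is the
leading coefficient of `F`. -/
theorem zInf_pow : C.zInf ^ C.d = Polynomial.aeval C.x⁻¹ C.F.reverse := by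
  have hx := C.x_ne_zero
  let _ : Invertible C.x := invertibleOfNonzero hx
  have h := Polynomial.eval₂_reverse_mul_pow (algebraMap k C.FunctionField) C.x C.F
  rw [invOf_eq_inv] at h
  rw [zInf, div_pow, ← pow_mul, ← pow_mul, m_div_d_mul, r_div_d_mul, y_pow,
    div_eq_iff (pow_ne_zero _ hx)]
  exact h.symm

variable {V : ValuationSubring C.FunctionField}

theorem leadingCoeff_ne_zero : C.F.leadingCoeff ≠ 0 :=
  Polynomial.leadingCoeff_ne_zero.2 C.separable.ne_zero

theorem valuation_x_inv_lt_one (hx : C.x ∉ V) :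
    V.valuation (C.x⁻¹ - algebraMap k C.FunctionField 0) < 1 := by
  rw [map_zero, sub_zero, valuation_lt_one_iff_inv_notMem (inv_ne_zero x_ne_zero), inv_inv]
  exact hx

theorem valuation_zInf_pow_sub_lt_one (hV : ∀ a : k, algebraMap k C.FunctionField a ∈ V)
    (hx : C.x ∉ V) :
    V.valuation (C.zInf ^ C.d - algebraMap k C.FunctionField C.F.leadingCoeff) < 1 := by
  have h := valuation_aeval_sub_lt_one hV (valuation_x_inv_lt_one hx) C.F.reverse
  rwa [← zInf_pow, ← Polynomial.coeff_zero_eq_eval_zero, Polynomial.coeff_zero_reverse] at h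

theorem exists_zInf_center [IsAlgClosed k] (hV : ∀ a : k, algebraMap k C.FunctionField a ∈ V)
    (hx : C.x ∉ V) : ∃ ζ : k, V.valuation (C.zInf - algebraMap k C.FunctionField ζ) < 1 := by
  have h : V.valuation
      (Polynomial.aeval C.zInf (Polynomial.X ^ C.d - Polynomial.C C.F.leadingCoeff)) < 1 := by
    rw [map_sub, map_pow, Polynomial.aeval_X, Polynomial.aeval_C]
    exact valuation_zInf_pow_sub_lt_one hV hx
  obtain ⟨ζ, -, hζ⟩ := exists_isRoot_valuation_sub_lt_one hV
    (Polynomial.X_pow_sub_C_ne_zero C.d_pos _) h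
  exact ⟨ζ, hζ⟩

theorem pow_eq_leadingCoeff (hV : ∀ a : k, algebraMap k C.FunctionField a ∈ V)
    (hx : C.x ∉ V) {ζ : k} (hζ : V.valuation (C.zInf - algebraMap k C.FunctionField ζ) < 1) :
    ζ ^ C.d = C.F.leadingCoeff := by
  have h1 := valuation_aeval_sub_lt_one hV hζ (Polynomial.X ^ C.d)
  rw [map_pow, Polynomial.aeval_X, Polynomial.eval_pow, Polynomial.eval_X] at h1
  exact eq_of_valuation_sub_lt_one hV h1 (valuation_zInf_pow_sub_lt_one hV hx)

theorem ne_zero_of_pow_eq_leadingCoeff {ζ : k} (h : ζ ^ C.d = C.F.leadingCoeff) : ζ ≠ 0 := by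
  rintro rfl
  rw [zero_pow C.d_pos.ne'] at h
  exact leadingCoeff_ne_zero h.symm

theorem valuation_zInf (hV : ∀ a : k, algebraMap k C.FunctionField a ∈ V)
    (hx : C.x ∉ V) {ζ : k} (hζ : V.valuation (C.zInf - algebraMap k C.FunctionField ζ) < 1) :
    V.valuation C.zInf = 1 :=
  valuation_eq_one_of_sub_lt_one hV
    (ne_zero_of_pow_eq_leadingCoeff (pow_eq_leadingCoeff hV hx hζ)) hζ

/-- 1/x is s^(m/d) times a power of the unit `z`. -/
theorem valuation_sInf_lt_one (hV : ∀ a : k, algebraMap k C.FunctionField a ∈ V)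
    (hx : C.x ∉ V) {ζ : k} (hζ : V.valuation (C.zInf - algebraMap k C.FunctionField ζ) < 1) :
    V.valuation C.sInf < 1 := by
  have h := valuation_x_inv_lt_one hx
  rw [map_zero, sub_zero, x_inv_eq, map_mul, map_pow, map_pow, valuation_zInf hV hx hζ, one_pow,
    mul_one] at h
  exact (pow_lt_one_iff C.m_div_d_pos.ne').1 h

theorem d_ne_zero : (C.d : k) ≠ 0 := by
  intro h
  apply C.m_ne_zero
  rw [← m_div_d_mul, Nat.cast_mul, h, mul_zero]

/-- The local ring at a point at infinity. -/
theorem infinity_local (hV : ∀ a : k, algebraMap k C.FunctionField a ∈ V)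
    (hx : C.x ∉ V) {ζ : k} (hζ : V.valuation (C.zInf - algebraMap k C.FunctionField ζ) < 1) :
    (∀ f ∈ V, ∃ p ∈ Algebra.adjoin k {C.sInf, C.zInf}, ∃ q ∈ Algebra.adjoin k {C.sInf, C.zInf},
      V.valuation q = 1 ∧ f = p / q) ∧
      (∀ f, V.valuation f < 1 → ∃ g ∈ V, f = g * C.sInf) ∧ IsDiscreteValuationRing V := by
  have hs := valuation_sInf_lt_one hV hx hζ
  have hsA : C.sInf ∈ Algebra.adjoin k {C.sInf, C.zInf} := Algebra.subset_adjoin (by simp)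
  have hzA : C.zInf ∈ Algebra.adjoin k {C.sInf, C.zInf} := Algebra.subset_adjoin (by simp)
  have hxA : C.x⁻¹ ∈ Algebra.adjoin k {C.sInf, C.zInf} := by
    rw [x_inv_eq]
    exact mul_mem (pow_mem hsA _) (pow_mem hzA _)
  have hpow := pow_eq_leadingCoeff hV hx hζ
  obtain ⟨Q, hQ, hQζ⟩ := exists_eq_mul_of_separable
    (Polynomial.separable_X_pow_sub_C C.F.leadingCoeff C.d_ne_zero leadingCoeff_ne_zero)
    (a := ζ) (by simp [hpow])
  obtain ⟨H, hH⟩ := Polynomial.X_sub_C_dvd_sub_C_eval (a := 0) (p := C.F.reverse)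
  refine exists_eq_div_of_smooth hV adjoin_sInf_zInf (a := 0) (b := ζ)
    (by rwa [map_zero, sub_zero]) hζ hsA sInf_ne_zero hs
    ⟨1, one_mem _, map_one _, 1, one_mem _, by rw [map_zero, sub_zero]⟩ ?_
  -- Q(z) (z - ζ) = z^d - ζ^d is the reversed polynomial at 1/x minus its constant term, hence
  -- H(1/x) · (1/x), and one factor `s` splits off 1/x.
  refine ⟨Polynomial.aeval C.zInf Q,
    Algebra.adjoin_mono (by simp) (Polynomial.aeval_mem_adjoin_singleton k C.zInf),
    valuation_aeval_eq_one hV hζ hQζ,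
    C.sInf ^ (C.m / C.d - 1) * C.zInf ^ C.expY * Polynomial.aeval C.x⁻¹ H,
    mul_mem (mul_mem (pow_mem hsA _) (pow_mem hzA _))
      (Algebra.adjoin_le (by simpa using hxA)
        (Polynomial.aeval_mem_adjoin_singleton k C.x⁻¹)), ?_⟩
  have h1 := congrArg (Polynomial.aeval C.zInf) hQ
  have h2 := congrArg (Polynomial.aeval C.x⁻¹) hH
  rw [← Polynomial.coeff_zero_eq_eval_zero, Polynomial.coeff_zero_reverse] at h2
  simp only [map_sub, map_mul, map_pow, Polynomial.aeval_X, Polynomial.aeval_C, map_zero, sub_zero,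
    ← zInf_pow] at h1 h2
  have h3 : C.x⁻¹ = C.sInf ^ (C.m / C.d - 1) * C.sInf * C.zInf ^ C.expY := by
    rw [x_inv_eq, ← pow_succ, Nat.sub_add_cancel C.m_div_d_pos]
  linear_combination h2 - h1 + Polynomial.aeval C.x⁻¹ H * h3

end Infinity

end

end SuperellipticCurve

namespace SuperellipticCurve

open PlaneCurve

noncomputable section

variable {k : Type u} [Field k] {C : SuperellipticCurve k}

/-! ### The ramification points -/

section RootPoint

/-- If 1/f = p/q with q nonzero at the point, then q = p f would vanish there. -/
theorem valuation_rootPoint_lt_one {a : k} (ha : C.F.IsRoot a) {f : C.CoordinateRing}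
    (hf0 : algebraMap C.CoordinateRing C.FunctionField f ≠ 0) (hf : evalRoot ha f = 0) :
    (rootPoint ha).localRing.valuation (algebraMap C.CoordinateRing C.FunctionField f) < 1 := by
  rw [valuation_lt_one_iff_inv_notMem hf0]
  intro hmem
  obtain ⟨p, q, hq, h⟩ := (mem_rootLocalRing ha _).1 hmem
  have hq0 : algebraMap C.CoordinateRing C.FunctionField q ≠ 0 := by
    intro h0
    rw [map_eq_zero_iff _ (IsFractionRing.injective _ _)] at h0
    exact hq (by rw [h0, map_zero])
  have h1 : q = p * f := by
    apply IsFractionRing.injective C.CoordinateRing C.FunctionField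
    rw [map_mul]
    field_simp at h
    linear_combination h
  exact hq (by rw [h1, map_mul, hf, mul_zero])

theorem rootPoint_x {a : k} (ha : C.F.IsRoot a) : (rootPoint ha).localRing.valuation
    (C.x - algebraMap k C.FunctionField a) < 1 := by
  have h : C.x - algebraMap k C.FunctionField a = algebraMap C.CoordinateRing C.FunctionField
      (AdjoinRoot.of C.equation (Polynomial.X - Polynomial.C a)) := by
    rw [algebraMap_of, map_sub, Polynomial.aeval_X, Polynomial.aeval_C]
  have h0 := x_sub_ne_zero (C := C) a
  rw [h] at h0 ⊢
  exact valuation_rootPoint_lt_one ha h0 (by simp [evalRoot, AdjoinRoot.lift_of])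

theorem rootPoint_y {a : k} (ha : C.F.IsRoot a) : (rootPoint ha).localRing.valuation
    (C.y - algebraMap k C.FunctionField 0) < 1 := by
  rw [map_zero, sub_zero]
  exact valuation_rootPoint_lt_one ha y_ne_zero (AdjoinRoot.lift_root _)

theorem eq_rootPoint {a : k} (ha : C.F.IsRoot a) {P : C.Point}
    (hx : P.localRing.valuation (C.x - algebraMap k C.FunctionField a) < 1)
    (hy : P.localRing.valuation (C.y - algebraMap k C.FunctionField 0) < 1) : P = rootPoint ha :=
  Point.ext (eq_of_center_eq P.algebraMap_mem (rootPoint ha).algebraMap_mem hx hy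
    (rootPoint_x ha) (rootPoint_y ha) (affine_local_of_isRoot P.algebraMap_mem ha hx hy).1
    (affine_local_of_isRoot (rootPoint ha).algebraMap_mem ha (rootPoint_x ha) (rootPoint_y ha)).1)

theorem rootPoint_x_mem {a : k} (ha : C.F.IsRoot a) : C.x ∈ (rootPoint ha).localRing := by
  have := add_mem (((rootPoint ha).localRing.valuation_le_one_iff _).1 (rootPoint_x ha).le)
    ((rootPoint ha).algebraMap_mem a)
  rwa [sub_add_cancel] at this

theorem rootPoint_injective {a b : k} (ha : C.F.IsRoot a) (hb : C.F.IsRoot b)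
    (h : rootPoint ha = rootPoint hb) : a = b := by
  have hx := rootPoint_x ha
  rw [h] at hx
  exact eq_of_valuation_sub_lt_one (rootPoint hb).algebraMap_mem hx (rootPoint_x hb)

theorem ord_rootPoint_y {a : k} (ha : C.F.IsRoot a) : (rootPoint ha).ord C.y = 1 := by
  have hy := rootPoint_y ha
  rw [map_zero, sub_zero] at hy
  exact (rootPoint ha).ord_eq_one y_ne_zero hy (affine_local_of_isRoot
    (rootPoint ha).algebraMap_mem ha (rootPoint_x ha) (rootPoint_y ha)).2.1

/-- Compare orders in y^m = (x - a) G(x), where `y` is a parameter and G(x) a unit. -/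
theorem ord_rootPoint_x_sub {a : k} (ha : C.F.IsRoot a) :
    (rootPoint ha).ord (C.x - algebraMap k C.FunctionField a) = C.m := by
  obtain ⟨G, hG, hGa⟩ := exists_eq_mul_of_separable C.separable ha
  have hG1 := valuation_aeval_eq_one (rootPoint ha).algebraMap_mem (rootPoint_x ha) hGa
  have hG0 : Polynomial.aeval C.x G ≠ 0 := fun h => by
    rw [h, map_zero] at hG1
    exact zero_ne_one hG1
  have h : C.y ^ C.m = (C.x - algebraMap k C.FunctionField a) * Polynomial.aeval C.x G := by
    rw [y_pow, hG, map_mul, map_sub, Polynomial.aeval_X, Polynomial.aeval_C]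
  have h1 := congrArg (rootPoint ha).ord h
  rw [Point.ord_pow _ y_ne_zero, Point.ord_mul _ (x_sub_ne_zero a) hG0, ord_rootPoint_y,
    Point.ord_eq_zero _ hG1] at h1
  linarith

/-- A polynomial in `x` vanishes at a ramification point to an order divisible by `m`. -/
theorem dvd_ord_rootPoint_aeval_x {a : k} (ha : C.F.IsRoot a) {p : Polynomial k} (hp : p ≠ 0) :
    (C.m : ℤ) ∣ (rootPoint ha).ord (Polynomial.aeval C.x p) := by
  obtain ⟨q, hq, hqa⟩ := Polynomial.exists_eq_pow_rootMultiplicity_mul_and_not_dvd p hp a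
  rw [Polynomial.dvd_iff_isRoot] at hqa
  have hq1 := valuation_aeval_eq_one (rootPoint ha).algebraMap_mem (rootPoint_x ha) hqa
  have hq0 : Polynomial.aeval C.x q ≠ 0 := fun h => by
    rw [h, map_zero] at hq1
    exact zero_ne_one hq1
  rw [hq, map_mul, map_pow, map_sub, Polynomial.aeval_X, Polynomial.aeval_C,
    Point.ord_mul _ (pow_ne_zero _ (x_sub_ne_zero a)) hq0, Point.ord_pow _ (x_sub_ne_zero a),
    ord_rootPoint_x_sub, Point.ord_eq_zero _ hq1, add_zero]
  exact Dvd.intro_left _ rfl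

end RootPoint

/-! ### Counting the points at infinity; functions without zeros and poles -/

theorem Point.localRing_ne_top (P : C.Point) : P.localRing ≠ ⊤ := by
  intro h
  have hDVR := P.isDVR
  rw [h] at hDVR
  apply hDVR.not_a_field
  rw [eq_bot_iff]
  intro f hf
  have h1 : ((f : C.FunctionField))⁻¹ ∈ (⊤ : ValuationSubring C.FunctionField) :=
    ValuationSubring.mem_top _
  by_contra hf0
  have hf0' : (f : C.FunctionField) ≠ 0 := fun h0 => hf0 (Subtype.ext h0)
  exact (valuation_lt_one_iff_inv_notMem hf0').1 ((ValuationSubring.valuation_lt_one_iff _ f).1 hf)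
    h1

theorem mem_pointsAtInfinity_iff {P : C.Point} : P ∈ C.pointsAtInfinity ↔ C.x ∉ P.localRing := by
  change ¬ (C.x ∈ P.localRing ∧ C.y ∈ P.localRing) ↔ _
  rw [not_iff_not]
  exact ⟨fun h => h.1, fun h => ⟨h, y_mem P.algebraMap_mem h⟩⟩

theorem rootPoint_notMem_pointsAtInfinity {a : k} (ha : C.F.IsRoot a) :
    rootPoint ha ∉ C.pointsAtInfinity := fun h =>
  mem_pointsAtInfinity_iff.1 h (rootPoint_x_mem ha)

/-- A point at infinity at which `zInf` takes a given value. -/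
def infinityPoint {V : ValuationSubring C.FunctionField}
    (hV : ∀ a : k, algebraMap k C.FunctionField a ∈ V) (hx : C.x ∉ V) {ζ : k}
    (hζ : V.valuation (C.zInf - algebraMap k C.FunctionField ζ) < 1) : C.Point where
  localRing := V
  algebraMap_mem := hV
  isDVR := (infinity_local hV hx hζ).2.2

/-- `x` is transcendental over `k`, so it has a pole. -/
theorem exists_x_notMem :
    ∃ V : ValuationSubring C.FunctionField, (∀ a : k, algebraMap k C.FunctionField a ∈ V) ∧
      C.x ∉ V := by
  refine exists_notMem_of_not_isIntegral fun hint => ?_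
  exact minpoly.ne_zero hint (aeval_x_eq_zero_iff.1 (minpoly.aeval k C.x))

theorem eq_of_zInf_center {P Q : C.Point} (hP : P ∈ C.pointsAtInfinity)
    (hQ : Q ∈ C.pointsAtInfinity) {ζ : k}
    (hPζ : P.localRing.valuation (C.zInf - algebraMap k C.FunctionField ζ) < 1)
    (hQζ : Q.localRing.valuation (C.zInf - algebraMap k C.FunctionField ζ) < 1) : P = Q := by
  rw [mem_pointsAtInfinity_iff] at hP hQ
  refine Point.ext (eq_of_center_eq (a := 0) (b := ζ) P.algebraMap_mem Q.algebraMap_mem ?_ hPζ ?_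
    hQζ (infinity_local P.algebraMap_mem hP hPζ).1 (infinity_local Q.algebraMap_mem hQ hQζ).1)
  · rw [map_zero, sub_zero]
    exact valuation_sInf_lt_one P.algebraMap_mem hP hPζ
  · rw [map_zero, sub_zero]
    exact valuation_sInf_lt_one Q.algebraMap_mem hQ hQζ

variable [IsAlgClosed k]

/-- A function without zeros and poles is constant. -/
theorem exists_eq_algebraMap_of_ord_eq_zero {f : C.FunctionField}
    (hf : ∀ P : C.Point, P.ord f = 0) : ∃ c : k, f = algebraMap k C.FunctionField c := by
  by_cases hint : IsIntegral k f
  · have hbij := IsAlgClosed.algebraMap_bijective_of_isIntegral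
      (k := k) (K := integralClosure k C.FunctionField)
    obtain ⟨c, hc⟩ := hbij.2 ⟨f, hint⟩
    exact ⟨c, (congrArg Subtype.val hc).symm⟩
  · obtain ⟨V, hV, hfV⟩ := exists_notMem_of_not_isIntegral hint
    -- The trivial valuation ring must be excluded, since it is not a point.
    have htop : V ≠ ⊤ := fun h => hfV (h ▸ ValuationSubring.mem_top f)
    have hpoint : ∃ P : C.Point, P.localRing = V := by
      by_cases hx : C.x ∈ V
      · exact ⟨⟨V, hV, isDVR_of_x_mem hV htop hx⟩, rfl⟩
      · obtain ⟨ζ, hζ⟩ := exists_zInf_center hV hx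
        exact ⟨infinityPoint hV hx hζ, rfl⟩
    obtain ⟨P, rfl⟩ := hpoint
    exact absurd (hf P) (P.ord_neg hfV).ne

/-- Some place at infinity exists, with value ξ of `z`. Pulling it back along y ↦ ω y with ω^(m/d) =
ζ/ξ moves this value to ζ. -/
theorem exists_infinityPoint {ζ : k} (hζ : ζ ^ C.d = C.F.leadingCoeff) :
    ∃ P ∈ C.pointsAtInfinity,
      P.localRing.valuation (C.zInf - algebraMap k C.FunctionField ζ) < 1 := by
  obtain ⟨V, hV, hx⟩ := exists_x_notMem (C := C)
  obtain ⟨ξ, hξ⟩ := exists_zInf_center hV hx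
  have hξd := pow_eq_leadingCoeff hV hx hξ
  have hξ0 := ne_zero_of_pow_eq_leadingCoeff hξd
  have hζ0 := ne_zero_of_pow_eq_leadingCoeff hζ
  obtain ⟨ω, hω⟩ := IsAlgClosed.exists_pow_nat_eq (ζ / ξ) C.m_div_d_pos
  -- ζ and ξ have the same d-th power, so ω^m = (ζ/ξ)^d = 1 and the scaling is defined.
  have hωm : ω ^ C.m = 1 := by
    rw [← m_div_d_mul, pow_mul, hω, div_pow, hζ, hξd, div_self leadingCoeff_ne_zero]
  obtain ⟨σ, hσx, hσy⟩ := exists_scale hωm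
  have hσz : σ C.zInf = algebraMap k C.FunctionField (ζ / ξ) * C.zInf := by
    rw [zInf, map_div₀, map_pow, map_pow, hσx, hσy, mul_pow, ← map_pow, hω, mul_div_assoc]
  have hV' : ∀ a : k, algebraMap k C.FunctionField a ∈ V.comap σ.toRingHom := fun a => by
    change σ _ ∈ V
    rw [σ.commutes]
    exact hV a
  have hx' : C.x ∉ V.comap σ.toRingHom := by
    change ¬ σ C.x ∈ V
    rwa [hσx]
  have hz' : (V.comap σ.toRingHom).valuation
      (C.zInf - algebraMap k C.FunctionField ζ) < 1 := by
    by_cases h0 : C.zInf - algebraMap k C.FunctionField ζ = 0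
    · rw [h0, map_zero]
      exact zero_lt_one
    · rw [valuation_lt_one_iff_inv_notMem h0]
      change ¬ σ _ ∈ V
      rw [map_inv₀, ← valuation_lt_one_iff_inv_notMem ((map_ne_zero σ).2 h0), map_sub, hσz,
        σ.commutes]
      have h1 : algebraMap k C.FunctionField (ζ / ξ) * C.zInf - algebraMap k C.FunctionField ζ =
          algebraMap k C.FunctionField (ζ / ξ) * (C.zInf - algebraMap k C.FunctionField ξ) := by
        rw [mul_sub, ← map_mul, div_mul_cancel₀ _ hξ0]
      rwa [h1, map_mul, valuation_algebraMap_eq_one hV (div_ne_zero hζ0 hξ0), one_mul]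
  exact ⟨infinityPoint hV' hx' hz', mem_pointsAtInfinity_iff.2 hx', hz'⟩

/-- The points at infinity correspond to the `d`-th roots of the leading coefficient of `F`. -/
theorem exists_equiv_pointsAtInfinity :
    Nonempty (C.pointsAtInfinity ≃ {ζ // ζ ∈ (Polynomial.X ^ C.d -
      Polynomial.C C.F.leadingCoeff : Polynomial k).rootSet k}) := by
  have hroot : ∀ ζ : k, ζ ∈ (Polynomial.X ^ C.d -
      Polynomial.C C.F.leadingCoeff : Polynomial k).rootSet k ↔ ζ ^ C.d = C.F.leadingCoeff := by
    intro ζ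
    rw [Polynomial.mem_rootSet_of_ne (Polynomial.X_pow_sub_C_ne_zero C.d_pos _)]
    simp [sub_eq_zero]
  choose z hz using fun P : C.pointsAtInfinity =>
    exists_zInf_center P.1.algebraMap_mem (mem_pointsAtInfinity_iff.1 P.2)
  refine ⟨Equiv.ofBijective (fun P => ⟨z P, (hroot _).2 (pow_eq_leadingCoeff P.1.algebraMap_mem
    (mem_pointsAtInfinity_iff.1 P.2) (hz P))⟩) ⟨fun P Q h => ?_, fun ζ => ?_⟩⟩
  · have h' : z P = z Q := congrArg Subtype.val h
    exact Subtype.ext (eq_of_zInf_center P.2 Q.2 (hz P) (h' ▸ hz Q))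
  · obtain ⟨P, hP, hPζ⟩ := exists_infinityPoint ((hroot _).1 ζ.2)
    exact ⟨⟨P, hP⟩, Subtype.ext (eq_of_valuation_sub_lt_one P.algebraMap_mem (hz ⟨P, hP⟩) hPζ)⟩

variable (C)

theorem finite_pointsAtInfinity : C.pointsAtInfinity.Finite := by
  obtain ⟨e⟩ := exists_equiv_pointsAtInfinity (C := C)
  have := Finite.of_equiv _ e.symm
  exact Set.toFinite _

theorem ncard_pointsAtInfinity : C.pointsAtInfinity.ncard = C.d := by
  obtain ⟨e⟩ := exists_equiv_pointsAtInfinity (C := C)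
  rw [← Nat.card_coe_set_eq, Nat.card_congr e, Nat.card_eq_fintype_card,
    Polynomial.card_rootSet_eq_natDegree
      (Polynomial.separable_X_pow_sub_C _ C.d_ne_zero leadingCoeff_ne_zero) (IsAlgClosed.splits _),
    Polynomial.natDegree_X_pow_sub_C]

theorem infinity_eq_sum :
    C.infinity = ∑ P ∈ C.finite_pointsAtInfinity.toFinset, Finsupp.single P 1 :=
  finsum_mem_eq_finite_toFinset_sum _ _

open Classical in
theorem infinity_apply (P : C.Point) : C.infinity P = if P ∈ C.pointsAtInfinity then 1 else 0 := by
  rw [infinity_eq_sum, Finsupp.finsetSum_apply]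
  simp [Finsupp.single_apply]

theorem degree_infinity : C.degree C.infinity = C.d := by
  rw [infinity_eq_sum, map_sum, ← C.ncard_pointsAtInfinity,
    Set.ncard_eq_toFinset_card _ C.finite_pointsAtInfinity]
  simp [degree]

end

end SuperellipticCurve

/-! ### The divisors of y and x - α_i, and the principal divisors supported on R_i and ∞ -/

namespace SuperellipticCurve

open PlaneCurve

noncomputable section

variable {k : Type u} [Field k] {C : SuperellipticCurve k}

theorem ord_infinity_sInf [IsAlgClosed k] {P : C.Point} (hP : P ∈ C.pointsAtInfinity) :
    P.ord C.sInf = 1 ∧ P.ord C.zInf = 0 := by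
  have hx := mem_pointsAtInfinity_iff.1 hP
  obtain ⟨ζ, hζ⟩ := exists_zInf_center P.algebraMap_mem hx
  exact ⟨P.ord_eq_one sInf_ne_zero (valuation_sInf_lt_one P.algebraMap_mem hx hζ)
    (infinity_local P.algebraMap_mem hx hζ).2.1,
    P.ord_eq_zero (valuation_zInf P.algebraMap_mem hx hζ)⟩

theorem ord_infinity_x [IsAlgClosed k] {P : C.Point} (hP : P ∈ C.pointsAtInfinity) :
    P.ord C.x = -((C.m / C.d : ℕ) : ℤ) := by
  obtain ⟨hs, hz⟩ := ord_infinity_sInf hP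
  have h := congrArg P.ord C.x_inv_eq
  rw [P.ord_inv, P.ord_mul (pow_ne_zero _ sInf_ne_zero) (pow_ne_zero _ zInf_ne_zero),
    P.ord_pow sInf_ne_zero, P.ord_pow zInf_ne_zero, hs, hz] at h
  linarith

theorem ord_infinity_y [IsAlgClosed k] {P : C.Point} (hP : P ∈ C.pointsAtInfinity) :
    P.ord C.y = -((C.r / C.d : ℕ) : ℤ) := by
  obtain ⟨hs, hz⟩ := ord_infinity_sInf hP
  have h := congrArg P.ord C.y_inv_eq
  rw [P.ord_inv, P.ord_mul (pow_ne_zero _ sInf_ne_zero) (pow_ne_zero _ zInf_ne_zero),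
    P.ord_pow sInf_ne_zero, P.ord_pow zInf_ne_zero, hs, hz] at h
  linarith

/-- x - a = x (1 - a/x), and the second factor has residue 1 at infinity. -/
theorem ord_infinity_x_sub [IsAlgClosed k] {P : C.Point} (hP : P ∈ C.pointsAtInfinity) (a : k) :
    P.ord (C.x - algebraMap k C.FunctionField a) = -((C.m / C.d : ℕ) : ℤ) := by
  have hx := valuation_x_inv_lt_one (mem_pointsAtInfinity_iff.1 hP)
  have h1 := valuation_aeval_eq_one P.algebraMap_mem hx (p := 1 - Polynomial.C a * Polynomial.X)
    (by simp)
  rw [map_sub, map_mul, map_one, Polynomial.aeval_C, Polynomial.aeval_X] at h1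
  have h0 : 1 - algebraMap k C.FunctionField a * C.x⁻¹ ≠ 0 := fun h => by
    rw [h, map_zero] at h1
    exact zero_ne_one h1
  have h : C.x - algebraMap k C.FunctionField a =
      C.x * (1 - algebraMap k C.FunctionField a * C.x⁻¹) := by
    have := C.x_ne_zero
    field_simp
  rw [h, P.ord_mul x_ne_zero h0, P.ord_eq_zero h1, ord_infinity_x hP, add_zero]

variable {ι : Type*} {α : ι → k}

/-- Away from the points `(a, 0)` and from infinity, the functions `y` and `x - α i` have neither
zeros nor poles. -/
theorem ord_eq_zero_of_affine [IsAlgClosed k] (hα : ∀ i, C.F.IsRoot (α i)) {P : C.Point}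
    (hP : P ∉ C.pointsAtInfinity) (hne : ∀ a (ha : C.F.IsRoot a), P ≠ rootPoint ha) :
    P.ord C.y = 0 ∧ ∀ i, P.ord (C.x - algebraMap k C.FunctionField (α i)) = 0 := by
  rw [mem_pointsAtInfinity_iff, not_not] at hP
  obtain ⟨a, b, ha, hb⟩ := exists_center P.algebraMap_mem P.localRing_ne_top hP
  have hab := pow_eq_eval_of_center P.algebraMap_mem ha hb
  have hFa : ¬ C.F.IsRoot a := fun h => by
    rw [Polynomial.IsRoot.def] at h
    rw [h] at hab
    obtain rfl := eq_zero_of_pow_eq_zero hab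
    exact hne a h (eq_rootPoint h ha hb)
  have hb0 : b ≠ 0 := fun h => hFa (by
    rw [Polynomial.IsRoot.def, ← hab, h, zero_pow C.m_pos.ne'])
  refine ⟨P.ord_eq_zero (valuation_eq_one_of_sub_lt_one P.algebraMap_mem hb0 hb), fun i => ?_⟩
  have h1 := valuation_aeval_eq_one P.algebraMap_mem ha
    (p := Polynomial.X - Polynomial.C (α i)) (by
      simp only [Polynomial.eval_sub, Polynomial.eval_X, Polynomial.eval_C]
      exact sub_ne_zero.2 fun h => hFa (h ▸ hα i))
  rw [map_sub, Polynomial.aeval_X, Polynomial.aeval_C] at h1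
  exact P.ord_eq_zero h1

variable [Fintype ι]

theorem sum_single_rootPoint_apply (hα : ∀ i, C.F.IsRoot (α i)) (hinj : Function.Injective α)
    (a : ι → ℤ) (i : ι) :
    (∑ j, Finsupp.single (rootPoint (hα j)) (a j)) (rootPoint (hα i)) = a i := by
  classical
  rw [Finsupp.finsetSum_apply, Finset.sum_eq_single i]
  · rw [Finsupp.single_eq_same]
  · intro j _ hj
    rw [Finsupp.single_apply, if_neg fun h => hj (hinj (rootPoint_injective _ _ h))]
  · simp

theorem sum_single_rootPoint_apply_of_ne (hα : ∀ i, C.F.IsRoot (α i)) (a : ι → ℤ) {P : C.Point}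
    (hP : ∀ i, P ≠ rootPoint (hα i)) :
    (∑ j, Finsupp.single (rootPoint (hα j)) (a j)) P = 0 := by
  classical
  rw [Finsupp.finsetSum_apply]
  exact Finset.sum_eq_zero fun j _ => by rw [Finsupp.single_apply, if_neg (hP j).symm]

variable [IsAlgClosed k]

/-- The divisor of `y`. -/
theorem ord_y (hα : ∀ i, C.F.IsRoot (α i)) (hinj : Function.Injective α)
    (hsurj : ∀ a, C.F.IsRoot a → ∃ i, α i = a) (P : C.Point) :
    P.ord C.y = (∑ i, Finsupp.single (rootPoint (hα i)) (1 : ℤ)) P -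
      ((C.r / C.d : ℕ) : ℤ) * C.infinity P := by
  rw [infinity_apply]
  split_ifs with hP
  · rw [ord_infinity_y hP, sum_single_rootPoint_apply_of_ne hα _ fun i h =>
      rootPoint_notMem_pointsAtInfinity (hα i) (h ▸ hP)]
    ring
  · by_cases hR : ∃ i, P = rootPoint (hα i)
    · obtain ⟨i, rfl⟩ := hR
      rw [ord_rootPoint_y, sum_single_rootPoint_apply hα hinj]
      ring
    · push Not at hR
      rw [sum_single_rootPoint_apply_of_ne hα _ hR, (ord_eq_zero_of_affine hα hP ?_).1]
      · ring
      · intro a ha h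
        obtain ⟨i, rfl⟩ := hsurj a ha
        exact hR i h

/-- The divisor of `∏ (x - α i) ^ e i`. -/
theorem ord_prod_x_sub (hα : ∀ i, C.F.IsRoot (α i)) (hinj : Function.Injective α)
    (hsurj : ∀ a, C.F.IsRoot a → ∃ i, α i = a) (e : ι → ℤ) (P : C.Point) :
    P.ord (∏ i, (C.x - algebraMap k C.FunctionField (α i)) ^ e i) =
      C.m * (∑ i, Finsupp.single (rootPoint (hα i)) (e i)) P -
        ((C.m / C.d : ℕ) : ℤ) * (∑ i, e i) * C.infinity P := by
  rw [P.ord_prod _ fun i _ => zpow_ne_zero _ (x_sub_ne_zero _)]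
  simp_rw [P.ord_zpow (x_sub_ne_zero _)]
  rw [infinity_apply]
  split_ifs with hP
  · simp_rw [ord_infinity_x_sub hP]
    rw [sum_single_rootPoint_apply_of_ne hα _ fun i h =>
      rootPoint_notMem_pointsAtInfinity (hα i) (h ▸ hP), ← Finset.sum_mul]
    ring
  · by_cases hR : ∃ i, P = rootPoint (hα i)
    · obtain ⟨i, rfl⟩ := hR
      rw [sum_single_rootPoint_apply hα hinj, Finset.sum_eq_single i]
      · rw [ord_rootPoint_x_sub]
        ring
      · intro j _ hj
        have h1 := valuation_aeval_eq_one (rootPoint (hα i)).algebraMap_mem (rootPoint_x (hα i))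
          (p := Polynomial.X - Polynomial.C (α j)) (by
            simp only [Polynomial.eval_sub, Polynomial.eval_X, Polynomial.eval_C]
            exact sub_ne_zero.2 fun h => hj (hinj h.symm))
        rw [map_sub, Polynomial.aeval_X, Polynomial.aeval_C] at h1
        rw [Point.ord_eq_zero _ h1, mul_zero]
      · simp
    · push Not at hR
      have h0 := (ord_eq_zero_of_affine hα hP fun a ha h => by
        obtain ⟨i, rfl⟩ := hsurj a ha
        exact hR i h).2
      simp_rw [h0]
      rw [sum_single_rootPoint_apply_of_ne hα _ hR]
      simp

/-- A function whose `m`-th power is a function of `x` is `y ^ j` times a function of `x`; hence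
its orders at the ramification points are congruent modulo `m`. -/
theorem dvd_ord_sub_ord_of_pow_eq {f g : C.FunctionField} (hf : f ≠ 0)
    (hg : ∀ σ : C.FunctionField →ₐ[k] C.FunctionField, σ C.x = C.x → σ g = g)
    (hfg : f ^ C.m = g) : ∃ j : ℕ, ∀ a (ha : C.F.IsRoot a),
      (C.m : ℤ) ∣ (rootPoint ha).ord f - j := by
  have : NeZero (C.m : k) := ⟨C.m_ne_zero⟩
  have : NeZero C.m := ⟨C.m_pos.ne'⟩
  obtain ⟨ω, hω⟩ := HasEnoughRootsOfUnity.exists_primitiveRoot k C.m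
  obtain ⟨σ, hσx, hσy⟩ := exists_scale (C := C) hω.pow_eq_one
  have hσp : ∀ p : Polynomial k, σ (Polynomial.aeval C.x p) = Polynomial.aeval C.x p := fun p => by
    rw [← Polynomial.aeval_algHom_apply, hσx]
  have hpow : (σ f / f) ^ C.m = 1 := by
    rw [div_pow, ← map_pow, hfg, hg σ hσx, div_self]
    rw [← hfg]
    exact pow_ne_zero _ hf
  have hω' : IsPrimitiveRoot (algebraMap k C.FunctionField ω) C.m :=
    hω.map_of_injective (algebraMap k C.FunctionField).injective
  obtain ⟨j, hj, hjω⟩ := hω'.eq_pow_of_pow_eq_one hpow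
  have hσf : σ f = algebraMap k C.FunctionField ω ^ j * f := by
    rw [hjω, div_mul_cancel₀ _ hf]
  obtain ⟨p, q, hq, hfpq⟩ := exists_eq_sum_div f
  have hq0 : Polynomial.aeval C.x q ≠ 0 := fun h => hq (aeval_x_eq_zero_iff.1 h)
  -- Applying `σ` to the expansion of `f` multiplies the i-th term by ω^i, while `σ f = ω^j f`; so
  -- (ω^i - ω^j) p_i = 0.
  have hp0 : ∀ i < C.m, i ≠ j → p i = 0 := by
    intro i hi hij
    have hsum : ∑ i ∈ Finset.range C.m, Polynomial.aeval C.x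
        (Polynomial.C (ω ^ i - ω ^ j) * p i) * C.y ^ i = 0 := by
      have h1 : σ f * Polynomial.aeval C.x q =
          ∑ i ∈ Finset.range C.m, algebraMap k C.FunctionField ω ^ i *
            (Polynomial.aeval C.x (p i) * C.y ^ i) := by
        rw [hfpq, map_div₀, hσp, div_mul_cancel₀ _ hq0, map_sum]
        refine Finset.sum_congr rfl fun i _ => ?_
        rw [map_mul, hσp, map_pow, hσy]
        ring
      have h2 : σ f * Polynomial.aeval C.x q =
          ∑ i ∈ Finset.range C.m, algebraMap k C.FunctionField ω ^ j *
            (Polynomial.aeval C.x (p i) * C.y ^ i) := by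
        rw [hσf, hfpq, mul_assoc, div_mul_cancel₀ _ hq0, Finset.mul_sum]
      rw [← sub_eq_zero.2 (h1.symm.trans h2), ← Finset.sum_sub_distrib]
      refine Finset.sum_congr rfl fun i _ => ?_
      rw [map_mul, Polynomial.aeval_C, map_sub, map_pow, map_pow]
      ring
    have h3 := eq_zero_of_sum_eq_zero hsum hi
    refine (mul_eq_zero.1 h3).resolve_left fun h4 => hij ?_
    rw [Polynomial.C_eq_zero, sub_eq_zero] at h4
    exact hω.pow_inj hi hj h4
  have hf' : f = Polynomial.aeval C.x (p j) * C.y ^ j / Polynomial.aeval C.x q := by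
    rw [hfpq, Finset.sum_eq_single j]
    · intro i hi hij
      rw [hp0 i (Finset.mem_range.1 hi) hij, map_zero, zero_mul]
    · intro h
      exact absurd (Finset.mem_range.2 hj) h
  have hpj : p j ≠ 0 := by
    intro h
    rw [h, map_zero, zero_mul, zero_div] at hf'
    exact hf hf'
  have hpj0 : Polynomial.aeval C.x (p j) ≠ 0 := fun h => hpj (aeval_x_eq_zero_iff.1 h)
  refine ⟨j, fun a ha => ?_⟩
  rw [hf', Point.ord_div _ (mul_ne_zero hpj0 (pow_ne_zero _ y_ne_zero)) hq0,
    Point.ord_mul _ hpj0 (pow_ne_zero _ y_ne_zero), Point.ord_pow _ y_ne_zero, ord_rootPoint_y]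
  obtain ⟨t, ht⟩ := dvd_sub (dvd_ord_rootPoint_aeval_x ha hpj) (dvd_ord_rootPoint_aeval_x ha hq)
  exact ⟨t, by linear_combination ht⟩

/-- Which of the divisors `∑ a i • R i - b • ∞` of degree zero are principal. -/
theorem mem_principal_iff (hα : ∀ i, C.F.IsRoot (α i)) (hinj : Function.Injective α)
    (hsurj : ∀ a, C.F.IsRoot a → ∃ i, α i = a) (hcard : Fintype.card ι = C.r) {a : ι → ℤ} {b : ℤ}
    (hab : ∑ i, a i = C.d * b) :
    ∑ i, Finsupp.single (rootPoint (hα i)) (a i) - b • C.infinity ∈ C.principal ↔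
      ∀ i j, (C.m : ℤ) ∣ a i - a j := by
  have hmd : ((C.m / C.d : ℕ) : ℤ) * C.d = C.m := by exact_mod_cast C.m_div_d_mul
  have hrd : ((C.r / C.d : ℕ) : ℤ) * C.d = C.r := by exact_mod_cast C.r_div_d_mul
  have hd : (C.d : ℤ) ≠ 0 := by exact_mod_cast C.d_pos.ne'
  constructor
  · rintro ⟨f, hf, hdiv⟩
    let g : C.FunctionField := ∏ i, (C.x - algebraMap k C.FunctionField (α i)) ^ a i
    have hg0 : g ≠ 0 := Finset.prod_ne_zero_iff.2 fun i _ => zpow_ne_zero _ (x_sub_ne_zero _)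
    -- div f^m = m D_a, and the coefficients at infinity agree because (m/d) ∑ a_i = m b.
    have hconst : ∀ P : C.Point, P.ord (f ^ C.m / g) = 0 := by
      intro P
      rw [P.ord_div (pow_ne_zero _ hf) hg0, P.ord_pow hf, ← hdiv, ord_prod_x_sub hα hinj hsurj,
        Finsupp.sub_apply, Finsupp.smul_apply, hab, smul_eq_mul]
      linear_combination (-(b * C.infinity P)) * (-hmd)
    obtain ⟨c, hc⟩ := exists_eq_algebraMap_of_ord_eq_zero hconst
    rw [div_eq_iff hg0] at hc
    obtain ⟨j, hj⟩ := dvd_ord_sub_ord_of_pow_eq hf (fun σ hσ => by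
      rw [map_mul, σ.commutes, map_prod]
      congr 1
      refine Finset.prod_congr rfl fun i _ => ?_
      rw [map_zpow₀, map_sub, hσ, σ.commutes]) hc
    have ha : ∀ i, (rootPoint (hα i)).ord f = a i := fun i => by
      rw [← hdiv, Finsupp.sub_apply, Finsupp.smul_apply, sum_single_rootPoint_apply hα hinj,
        infinity_apply, if_neg (rootPoint_notMem_pointsAtInfinity _), smul_zero, sub_zero]
    intro i i'
    have h := dvd_sub (hj _ (hα i)) (hj _ (hα i'))
    rwa [ha, ha, sub_sub_sub_cancel_right] at h
  · intro h
    have hpos : 0 < Fintype.card ι := hcard ▸ C.r_pos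
    obtain ⟨i₀⟩ := Fintype.card_pos_iff.1 hpos
    choose e he using fun i => h i i₀
    have hae : a = fun i => a i₀ * 1 + C.m * e i := funext fun i => by linear_combination he i
    -- The coefficient of ∞ is forced by the degree: multiply by `d` and sum the previous identity
    -- over all `r` indices.
    have hb : b = a i₀ * ((C.r / C.d : ℕ) : ℤ) + ((C.m / C.d : ℕ) : ℤ) * ∑ i, e i := by
      apply mul_left_cancel₀ hd
      rw [← hab]
      conv_lhs => rw [hae]
      rw [Finset.sum_add_distrib, ← Finset.mul_sum, ← Finset.mul_sum, Finset.sum_const,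
        Finset.card_univ, hcard]
      simp only [nsmul_eq_mul]
      linear_combination (-a i₀) * hrd - (∑ i, e i) * hmd
    refine ⟨C.y ^ a i₀ * ∏ i, (C.x - algebraMap k C.FunctionField (α i)) ^ e i,
      mul_ne_zero (zpow_ne_zero _ y_ne_zero)
        (Finset.prod_ne_zero_iff.2 fun i _ => zpow_ne_zero _ (x_sub_ne_zero _)), fun P => ?_⟩
    rw [P.ord_mul (zpow_ne_zero _ y_ne_zero)
      (Finset.prod_ne_zero_iff.2 fun i _ => zpow_ne_zero _ (x_sub_ne_zero _)),
      P.ord_zpow y_ne_zero, ord_y hα hinj hsurj, ord_prod_x_sub hα hinj hsurj,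
      Finsupp.sub_apply, Finsupp.smul_apply, smul_eq_mul]
    have hsum : (∑ i, Finsupp.single (rootPoint (hα i)) (a i)) P =
        a i₀ * (∑ i, Finsupp.single (rootPoint (hα i)) (1 : ℤ)) P +
          C.m * (∑ i, Finsupp.single (rootPoint (hα i)) (e i)) P := by
      classical
      rw [Finsupp.finsetSum_apply, Finsupp.finsetSum_apply, Finsupp.finsetSum_apply,
        Finset.mul_sum, Finset.mul_sum, ← Finset.sum_add_distrib]
      refine Finset.sum_congr rfl fun i _ => ?_
      rw [Finsupp.single_apply, Finsupp.single_apply, Finsupp.single_apply]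
      split_ifs
      · exact congrFun hae i
      · ring
    rw [hsum, hb]
    ring

end

end SuperellipticCurve

/-! ### The abstract structure of the quotient of the group of tuples -/

/-- The tuples of integers whose sum is divisible by `d`. -/
def sumDvdSubgroup (r d : ℕ) : AddSubgroup (Fin r → ℤ) where
  carrier := {a | (d : ℤ) ∣ ∑ i, a i}
  zero_mem' := by simp
  add_mem' := fun {a b} ha hb => by
    change (d : ℤ) ∣ ∑ i, (a i + b i)
    rw [Finset.sum_add_distrib]
    exact dvd_add ha hb
  neg_mem' := fun {a} ha => by
    change (d : ℤ) ∣ ∑ i, -a i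
    rw [Finset.sum_neg_distrib]
    exact (dvd_neg (a := (d : ℤ))).2 ha

theorem mem_sumDvdSubgroup {r d : ℕ} {a : Fin r → ℤ} :
    a ∈ sumDvdSubgroup r d ↔ (d : ℤ) ∣ ∑ i, a i := Iff.rfl

/-- The tuples whose sum is divisible by `d`, modulo `m` and modulo constant tuples. -/
theorem exists_surjective_sumDvdSubgroup {m d r : ℕ} (hr : 2 ≤ r) (hd : 0 < d) (hdm : d ∣ m)
    (hdr : d ∣ r) :
    ∃ ψ : sumDvdSubgroup r d →+ (Fin (r - 2) → ZMod m) × ZMod (m / d),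
      Function.Surjective ψ ∧
        ∀ a : sumDvdSubgroup r d, ψ a = 0 ↔ ∀ i j, (m : ℤ) ∣ a.1 i - a.1 j := by
  obtain ⟨n, rfl⟩ := Nat.exists_eq_add_of_le' hr
  obtain ⟨m', rfl⟩ := hdm
  obtain ⟨r', hr'⟩ := hdr
  have hd0 : (d : ℤ) ≠ 0 := by exact_mod_cast hd.ne'
  have hrz : (n : ℤ) + 2 = d * r' := by exact_mod_cast hr'
  rw [Nat.mul_div_cancel_left _ hd, Nat.add_sub_cancel]
  let q : sumDvdSubgroup (n + 2) d →+ ℤ :=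
    { toFun := fun a => (∑ i, a.1 i) / d
      map_zero' := by simp
      map_add' := fun a b => by
        rw [← Int.add_ediv_of_dvd_left a.2, ← Finset.sum_add_distrib]
        rfl }
  have hq : ∀ a : sumDvdSubgroup (n + 2) d, d * q a = ∑ i, a.1 i :=
    fun a => Int.mul_ediv_cancel' a.2
  -- Subtracting the last entry kills constant tuples; adding a constant c to `a` changes (∑ a_i)/d
  -- by r' c, whence the correction term. The penultimate difference is left out, since the sum
  -- determines it.
  let ψ : sumDvdSubgroup (n + 2) d →+ (Fin n → ZMod (d * m')) × ZMod m' :=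
    { toFun := fun a => (fun i => ((a.1 i.castSucc.castSucc - a.1 (Fin.last _) : ℤ) : ZMod (d * m')),
        ((q a - r' * a.1 (Fin.last _) : ℤ) : ZMod m'))
      map_zero' := by ext <;> simp
      map_add' := fun a b => by
        ext
        · simp
          ring
        · simp
          ring }
  refine ⟨ψ, ?_, fun a => ?_⟩
  · rintro ⟨u, v⟩
    choose u' hu' using fun i => ZMod.intCast_surjective (u i)
    obtain ⟨v', rfl⟩ := ZMod.intCast_surjective v
    -- The last entry is 0, and the penultimate one adjusts the sum to `d * v'`.
    let a : Fin (n + 2) → ℤ :=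
      Fin.snoc (Fin.snoc u' (d * v' - ∑ i, u' i) : Fin (n + 1) → ℤ) (0 : ℤ)
    have hsum : ∑ i, a i = d * v' := by
      simp [a, Fin.sum_univ_castSucc]
    have hmem : a ∈ sumDvdSubgroup (n + 2) d := by
      rw [mem_sumDvdSubgroup, hsum]
      exact Dvd.intro _ rfl
    refine ⟨⟨a, hmem⟩, Prod.ext (funext fun i => ?_) ?_⟩
    · simp [ψ, a, hu']
    · have h1 : q ⟨a, hmem⟩ = v' := mul_left_cancel₀ hd0 ((hq _).trans hsum)
      change ((q ⟨a, hmem⟩ - r' * a (Fin.last _) : ℤ) : ZMod m') = v'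
      rw [h1]
      simp [a]
  · have h1 : ψ a = 0 ↔ (∀ i : Fin n, ((d * m' : ℕ) : ℤ) ∣
        a.1 i.castSucc.castSucc - a.1 (Fin.last _)) ∧ (m' : ℤ) ∣ q a - r' * a.1 (Fin.last _) := by
      rw [Prod.ext_iff, funext_iff, ← ZMod.intCast_zmod_eq_zero_iff_dvd]
      simp only [← ZMod.intCast_zmod_eq_zero_iff_dvd]
      rfl
    -- Multiply by `d`: since n + 2 = d r', the right-hand sum equals d (q a - r' a_last).
    have h2 : (m' : ℤ) ∣ q a - r' * a.1 (Fin.last _) ↔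
        ((d * m' : ℕ) : ℤ) ∣ ∑ i, (a.1 i - a.1 (Fin.last _)) := by
      rw [Nat.cast_mul, Finset.sum_sub_distrib, ← hq, Finset.sum_const, Finset.card_univ,
        Fintype.card_fin, nsmul_eq_mul, Nat.cast_add, Nat.cast_ofNat, hrz, mul_assoc, ← mul_sub,
        mul_dvd_mul_iff_left hd0]
    have h3 : ∑ i, (a.1 i - a.1 (Fin.last _)) =
        ∑ i : Fin n, (a.1 i.castSucc.castSucc - a.1 (Fin.last _)) +
          (a.1 (Fin.last n).castSucc - a.1 (Fin.last _)) := by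
      rw [Fin.sum_univ_castSucc, Fin.sum_univ_castSucc, sub_self, add_zero]
    rw [h1, h2]
    constructor
    · rintro ⟨hu, hv⟩
      have hlast : ∀ i, ((d * m' : ℕ) : ℤ) ∣ a.1 i - a.1 (Fin.last _) := by
        intro i
        refine Fin.lastCases (by simp) (fun i => ?_) i
        refine Fin.lastCases ?_ hu i
        rw [h3] at hv
        -- The penultimate difference is the full sum of differences minus the others, all divisible
        -- by `m`.
        exact (dvd_add_right (Finset.dvd_sum fun i _ => hu i)).1 hv
      intro i j
      simpa using dvd_sub (hlast i) (hlast j)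
    · intro h
      exact ⟨fun i => h _ _, Finset.dvd_sum fun i _ => h _ _⟩

/-! ### Descent of the data to K and the group Δ -/

namespace SuperellipticCurve

noncomputable section

variable {K : Type u} [Field K] {C : SuperellipticCurve K} {α : Fin C.r → K}

theorem geometric_r : C.geometric.r = C.r := Polynomial.natDegree_map _

theorem geometric_d : C.geometric.d = C.d := by
  rw [d, d, geometric_r]
  rfl

theorem roots_injective
    (hF : C.F = Polynomial.C C.F.leadingCoeff * ∏ i, (Polynomial.X - Polynomial.C (α i))) :
    Function.Injective α := by
  have hsep := C.separable
  rw [hF] at hsep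
  exact Polynomial.separable_prod_X_sub_C_iff.1 hsep.of_mul_right

theorem exists_eq_of_isRoot_geometric
    (hF : C.F = Polynomial.C C.F.leadingCoeff * ∏ i, (Polynomial.X - Polynomial.C (α i)))
    {a : AlgebraicClosure K} (ha : C.geometric.F.IsRoot a) :
    ∃ i, algebraMap K (AlgebraicClosure K) (α i) = a := by
  have h : C.geometric.F = Polynomial.C (algebraMap K (AlgebraicClosure K) C.F.leadingCoeff) *
      ∏ i, (Polynomial.X - Polynomial.C (algebraMap K (AlgebraicClosure K) (α i))) := by
    change C.F.map _ = _
    conv_lhs => rw [hF]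
    rw [Polynomial.map_mul, Polynomial.map_prod, Polynomial.map_C]
    simp
  rw [h, Polynomial.IsRoot.def, Polynomial.eval_mul, Polynomial.eval_C, Polynomial.eval_prod] at ha
  have h0 : algebraMap K (AlgebraicClosure K) C.F.leadingCoeff ≠ 0 := by
    simpa using C.separable.ne_zero
  obtain ⟨i, -, hi⟩ := Finset.prod_eq_zero_iff.1 ((mul_eq_zero.1 ha).resolve_left h0)
  exact ⟨i, (sub_eq_zero.1 (by simpa using hi)).symm⟩

/-- There are exactly `d` points at infinity, so `b • ∞` has degree `d * b`. -/
theorem rootDivisor_mem_divisorZero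
    (hF : C.F = Polynomial.C C.F.leadingCoeff * ∏ i, (Polynomial.X - Polynomial.C (α i)))
    {a : Fin C.r → ℤ} {b : ℤ} (hab : ∑ i, a i = C.d * b) :
    rootDivisor hF a b ∈ C.geometric.divisorZero := by
  change C.geometric.degree _ = 0
  rw [rootDivisor, map_sub, map_sum, map_zsmul, degree_infinity, geometric_d]
  have : ∀ i, C.geometric.degree (Finsupp.single (rootPoint (isRoot_geometric hF i)) (a i)) = a i :=
    fun i => by simp [degree]
  simp_rw [this]
  rw [hab, smul_eq_mul]
  ring

theorem rootDivisor_mem_principal_iff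
    (hF : C.F = Polynomial.C C.F.leadingCoeff * ∏ i, (Polynomial.X - Polynomial.C (α i)))
    {a : Fin C.r → ℤ} {b : ℤ} (hab : ∑ i, a i = C.d * b) :
    rootDivisor hF a b ∈ C.geometric.principal ↔ ∀ i j, (C.m : ℤ) ∣ a i - a j :=
  mem_principal_iff (C := C.geometric) (isRoot_geometric hF)
    ((algebraMap K (AlgebraicClosure K)).injective.comp (roots_injective hF))
    (fun _ => exists_eq_of_isRoot_geometric hF) (by rw [Fintype.card_fin, geometric_r])
    (by rw [geometric_d]; exact hab)

theorem rootDivisor_add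
    (hF : C.F = Polynomial.C C.F.leadingCoeff * ∏ i, (Polynomial.X - Polynomial.C (α i)))
    (a a' : Fin C.r → ℤ) (b b' : ℤ) :
    rootDivisor hF (a + a') (b + b') = rootDivisor hF a b + rootDivisor hF a' b' := by
  simp only [rootDivisor, Pi.add_apply, Finsupp.single_add, Finset.sum_add_distrib, add_smul]
  abel

/-- The homomorphism that maps `a` to the class of `∑ i, a i • R i - (1/d) (∑ i, a i) • ∞`. -/
def rootClass
    (hF : C.F = Polynomial.C C.F.leadingCoeff * ∏ i, (Polynomial.X - Polynomial.C (α i))) :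
    sumDvdSubgroup C.r C.d →+ C.Jacobian :=
  AddMonoidHom.mk' (fun a => QuotientAddGroup.mk ⟨rootDivisor hF a.1 ((∑ i, a.1 i) / C.d),
    rootDivisor_mem_divisorZero hF (Int.mul_ediv_cancel' a.2).symm⟩) fun a a' => by
      rw [← QuotientAddGroup.mk_add]
      congr 1
      refine Subtype.ext ?_
      change rootDivisor hF (a.1 + a'.1) _ = rootDivisor hF a.1 _ + rootDivisor hF a'.1 _
      rw [← rootDivisor_add, ← Int.add_ediv_of_dvd_left a.2, ← Finset.sum_add_distrib]
      rfl

theorem rootClass_eq_zero_iff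
    (hF : C.F = Polynomial.C C.F.leadingCoeff * ∏ i, (Polynomial.X - Polynomial.C (α i)))
    (a : sumDvdSubgroup C.r C.d) :
    rootClass hF a = 0 ↔ ∀ i j, (C.m : ℤ) ∣ a.1 i - a.1 j := by
  rw [← rootDivisor_mem_principal_iff hF (Int.mul_ediv_cancel' a.2).symm]
  exact QuotientAddGroup.eq_zero_iff _

theorem coe_range_rootClass
    (hF : C.F = Polynomial.C C.F.leadingCoeff * ∏ i, (Polynomial.X - Polynomial.C (α i))) :
    ((rootClass hF).range : Set C.Jacobian) = Delta hF := by
  ext c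
  constructor
  · rintro ⟨a, rfl⟩
    exact ⟨a.1, _, ⟨_, rootDivisor_mem_divisorZero hF (Int.mul_ediv_cancel' a.2).symm⟩,
      (Int.mul_ediv_cancel' a.2).symm, rfl, rfl⟩
  · rintro ⟨a, b, D, hab, hD, rfl⟩
    have hd : (C.d : ℤ) ≠ 0 := by exact_mod_cast C.d_pos.ne'
    refine ⟨⟨a, mem_sumDvdSubgroup.2 ⟨b, hab⟩⟩, ?_⟩
    change QuotientAddGroup.mk _ = _
    congr 1
    refine Subtype.ext ?_
    change rootDivisor hF a ((∑ i, a i) / C.d) = _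
    rw [hD, hab, Int.mul_ediv_cancel_left _ hd]

end

end SuperellipticCurve

theorem proposition1 {K : Type u} [Field K] [PerfectField K] (C : SuperellipticCurve K)
    (hr : 2 ≤ C.r) (α : Fin C.r → K)
    (hF : C.F = Polynomial.C C.F.leadingCoeff * ∏ i, (Polynomial.X - Polynomial.C (α i))) :
    (∀ (a : Fin C.r → ℤ) (b : ℤ), ∑ i, a i = C.d * b →
      SuperellipticCurve.rootDivisor hF a b ∈ C.geometric.divisorZero) ∧
    ∃ Δ : AddSubgroup C.Jacobian, (Δ : Set C.Jacobian) = SuperellipticCurve.Delta hF ∧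
      Nonempty (Δ ≃+ (Fin (C.r - 2) → ZMod C.m) × ZMod (C.m / C.d)) := by
  refine ⟨fun a b => SuperellipticCurve.rootDivisor_mem_divisorZero hF,
    (SuperellipticCurve.rootClass hF).range, SuperellipticCurve.coe_range_rootClass hF, ?_⟩
  obtain ⟨ψ, hψ, hker⟩ := exists_surjective_sumDvdSubgroup hr C.d_pos (Nat.gcd_dvd_left C.m C.r)
    (Nat.gcd_dvd_right C.m C.r)
  -- Δ and the explicit group are images of the same group of tuples under homomorphisms with equal
  -- kernels.
  have hkereq : (SuperellipticCurve.rootClass hF).ker = ψ.ker := by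
    ext a
    rw [AddMonoidHom.mem_ker, AddMonoidHom.mem_ker, hker,
      SuperellipticCurve.rootClass_eq_zero_iff]
  exact ⟨((QuotientAddGroup.quotientKerEquivRange _).symm.trans
    (QuotientAddGroup.quotientAddEquivOfEq hkereq)).trans
    (QuotientAddGroup.quotientKerEquivOfSurjective ψ hψ)⟩
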